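/- Let \[ V(t)=2(1+\sqrt t)\log(1+\sqrt t)+2(1-\sqrt t)\log(1-\sqrt t),\qquad t\in[0,1] \] (with $0\log 0=0$), and for $\gamma>1$ put $V_\gamma(t)=V(t/\gamma)$, $t\in[0,1]$. For an external field $W:[a,b]\to\mathbb R$, the equilibrium measure on $[a,b]$ is the unique probability measure $\mu$ with support in $[a,b]$ for which there is a real constant $\ell$ such that \[ 2\int\log|x-s|\,d\mu(s)\; \begin{cases} = W(x)+\ell, & x\in\operatorname{supp}\mu,\\ \le W(x)+\ell, & x\in[a,b]\setminus\operatorname{supp}\mu. \end{cases} \] **Lemma 4.5.** Let $\gamma>1$. The equilibrium measure $\mu_\gamma$ on $[0,1]$ for the external field $V_\gamma$ exists (and is unique), has support equal to $[0,1]$, and is absolutely continuous with respect to Lebesgue measure, with the positive density \[ \frac{d\mu_\gamma}{ds}=\frac{1}{\sqrt{\gamma s}}\left(\frac12+\frac1\pi\sqrt{\frac{\gamma-1}{1-s}}-\frac1\pi\arctan\sqrt{\frac{\gamma-1}{1-s}}\right),\qquad s\in(0,1). \] -/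

import Mathlib

open MeasureTheory Set

noncomputable section

/-- The external field
`V(t) = 2(1 + √t) log(1 + √t) + 2(1 - √t) log(1 - √t)` on `[0,1]`
(with the usual convention `0 log 0 = 0` at `t = 1`). -/
def besselField (t : ℝ) : ℝ :=
  2 * (1 + √t) * Real.log (1 + √t) + 2 * (1 - √t) * Real.log (1 - √t)

/-- The deformed external field `V_γ(t) = V(t/γ)`. -/
def besselFieldScaled (γ t : ℝ) : ℝ := besselField (t / γ)

/-- The logarithmic potential `∫ log|x - s| dμ(s)`, in which `log 0 = -∞`, is finite at `x`.
Since `Real.log 0 = 0` in Mathlib, the value `-∞` at `s = x` is accounted for separately: it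
contributes nothing exactly when `μ` has no atom at `x`. When this holds, the potential is the
Bochner integral `∫ s, Real.log |x - s| ∂μ`. -/
def HasFiniteLogPotential (μ : Measure ℝ) (x : ℝ) : Prop :=
  μ {x} = 0 ∧ Integrable (fun s => Real.log |x - s|) μ

/-- `μ` solves the equilibrium problem on `[a,b]` for the external field `W`: it is a probability
measure with support in `[a,b]` and, for some real constant `ℓ`,
`2 ∫ log|x - s| dμ(s)` equals `W x + ℓ` for `x` in the support of `μ`
and is at most `W x + ℓ` for the other `x` in `[a,b]`.

The logarithmic potential takes values in `[-∞, ∞)`, so the equality includes its finiteness.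
For `x` outside the support, `s ↦ log|x - s|` is bounded on the compact support, so that finiteness
is automatic there. -/
structure SolvesEquilibriumProblem (W : ℝ → ℝ) (a b : ℝ) (μ : Measure ℝ) : Prop where
  isProbabilityMeasure : IsProbabilityMeasure μ
  support_subset : μ.support ⊆ Icc a b
  exists_const : ∃ ℓ : ℝ,
    (∀ x ∈ μ.support, HasFiniteLogPotential μ x ∧
      2 * ∫ s, Real.log |x - s| ∂μ = W x + ℓ) ∧
    (∀ x ∈ Icc a b \ μ.support, 2 * ∫ s, Real.log |x - s| ∂μ ≤ W x + ℓ)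

/-- `μ` is the equilibrium measure on `[a,b]` for the external field `W`: the unique solution of
the equilibrium problem. -/
def IsEquilibriumMeasure (W : ℝ → ℝ) (a b : ℝ) (μ : Measure ℝ) : Prop :=
  SolvesEquilibriumProblem W a b μ ∧ ∀ ν : Measure ℝ, SolvesEquilibriumProblem W a b ν → ν = μ

/-- The explicit density
`(γs)^{-1/2} (1/2 + (1/π) √((γ-1)/(1-s)) - (1/π) arctan √((γ-1)/(1-s)))`, for `0 < s < 1`. -/
def equilibriumDensity (γ s : ℝ) : ℝ :=
  1 / √(γ * s) * (1 / 2 + 1 / Real.pi * √((γ - 1) / (1 - s))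
    - 1 / Real.pi * Real.arctan (√((γ - 1) / (1 - s))))

end

/-! Existence is a balayage computation. Up to an additive constant, `V_γ(x)/2` is `(1/√γ) ∫ log|x -
v²| dv` over `0 < v < √γ`, the logarithmic potential of the probability measure `ds/(2√(γs))` on
`[0,γ]`. The part of that measure on `[0,1]` gives the term `1/2` of the density. The part on
`[1,γ]` is swept onto `[0,1]`: with `s = (1 + cos t)/2`, the balayage of the unit mass at `1 + w²`
is a Poisson kernel in `t` over `π`, and sweeping changes the potential on `[0,1]` only by a
constant. Superposing these kernels produces the square root and arctangent terms
(`sq_div_sq_add_sin_sq`, `integral_mul_sub_arctan`). So twice the potential of the result is `V_γ +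
ℓ` on all of `[0,1]` (`exists_integral_log_mul_angularDensity`).

Uniqueness is strict negativity of the logarithmic energy on differences of probability measures. In
Chebyshev polynomials the kernel `log(2|X - Y|)` is `-∑ (2/n) T_n(X) T_n(Y)`, made convergent by an
Abel factor `ρ^n`. Hence the energy of `ν - μ` is at most minus each squared difference of moments,
up to a positive factor (`eq_of_logEnergy_nonneg`). The equilibrium conditions force that energy to
be nonnegative, so all moments agree. -/

open Filter Topology Polynomial

/-! ### The regularised logarithmic kernel and its Chebyshev expansion -/

/-- With `X = cos a` and `Y = cos b` this is the product of `1 - 2ρ cos (a + b) + ρ²` and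
`1 - 2ρ cos (a - b) + ρ²`. -/
def regQuartic (ρ X Y : ℝ) : ℝ :=
  (1 + ρ ^ 2) ^ 2 - 4 * ρ * (1 + ρ ^ 2) * (X * Y) + 4 * ρ ^ 2 * (X ^ 2 + Y ^ 2 - 1)

/-- The Abel regularisation of the logarithmic kernel `log (2 |X - Y|)` on `[-1, 1]`. -/
noncomputable def regLogKernel (ρ X Y : ℝ) : ℝ := 1 / 2 * Real.log (regQuartic ρ X Y)

lemma regQuartic_cos (ρ a b : ℝ) :
    regQuartic ρ (Real.cos a) (Real.cos b) =
      (1 - 2 * ρ * Real.cos (a + b) + ρ ^ 2) * (1 - 2 * ρ * Real.cos (a - b) + ρ ^ 2) := by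
  rw [Real.cos_add, Real.cos_sub, regQuartic]
  have ha := Real.sin_sq_add_cos_sq a
  have hb := Real.sin_sq_add_cos_sq b
  have ha' : Real.sin a ^ 2 = 1 - Real.cos a ^ 2 := by linarith
  have hb' : Real.sin b ^ 2 = 1 - Real.cos b ^ 2 := by linarith
  linear_combination (4 * ρ ^ 2 * Real.sin b ^ 2) * ha' + (4 * ρ ^ 2 * (1 - Real.cos a ^ 2)) * hb'

/-- Twice the difference of the two sides is the sum of the two products in the proof. The bound is
uniform in `ρ`, which is what lets `log|X - Y|` dominate the regularised kernels as `ρ → 1`. -/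
lemma half_one_sub_le {ρ c : ℝ} (h0 : 0 ≤ ρ) (hc : c ∈ Icc (-1 : ℝ) 1) :
    (1 - c) / 2 ≤ 1 - 2 * ρ * c + ρ ^ 2 := by
  have h2 : 0 ≤ (1 + c) * (1 - ρ) ^ 2 := mul_nonneg (by linarith [hc.1]) (sq_nonneg _)
  have h3 : 0 ≤ (1 - c) * (ρ * (2 + ρ)) :=
    mul_nonneg (by linarith [hc.2]) (by positivity)
  nlinarith

lemma sq_sub_div_four_le_regQuartic {ρ X Y : ℝ} (h0 : 0 ≤ ρ)
    (hX : X ∈ Icc (-1 : ℝ) 1) (hY : Y ∈ Icc (-1 : ℝ) 1) :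
    (X - Y) ^ 2 / 4 ≤ regQuartic ρ X Y := by
  rw [← Real.cos_arccos hX.1 hX.2, ← Real.cos_arccos hY.1 hY.2]
  set a := Real.arccos X
  set b := Real.arccos Y
  have e : regQuartic 1 (Real.cos a) (Real.cos b) = 4 * (Real.cos a - Real.cos b) ^ 2 := by
    unfold regQuartic; ring
  rw [regQuartic_cos] at e ⊢
  have e' : (Real.cos a - Real.cos b) ^ 2 / 4 =
    (1 - Real.cos (a + b)) / 2 * ((1 - Real.cos (a - b)) / 2) := by linarith
  rw [e']
  have p := Real.cos_le_one (a + b)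
  have m := Real.cos_le_one (a - b)
  exact mul_le_mul (half_one_sub_le h0 (Real.cos_mem_Icc _))
    (half_one_sub_le h0 (Real.cos_mem_Icc _)) (by linarith)
    (le_trans (by linarith) (half_one_sub_le h0 (Real.cos_mem_Icc (a + b))))

lemma regQuartic_le {ρ X Y : ℝ} (h0 : 0 ≤ ρ) (h1 : ρ ≤ 1)
    (hX : X ∈ Icc (-1 : ℝ) 1) (hY : Y ∈ Icc (-1 : ℝ) 1) : regQuartic ρ X Y ≤ 16 := by
  rw [← Real.cos_arccos hX.1 hX.2, ← Real.cos_arccos hY.1 hY.2, regQuartic_cos]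
  have key : ∀ t : ℝ, 0 ≤ 1 - 2 * ρ * Real.cos t + ρ ^ 2 ∧
      1 - 2 * ρ * Real.cos t + ρ ^ 2 ≤ 4 := by
    intro t
    have := Real.cos_mem_Icc t
    exact ⟨le_trans (by linarith [this.2]) (half_one_sub_le h0 this), by nlinarith [this.1]⟩
  nlinarith [key (Real.arccos X + Real.arccos Y), key (Real.arccos X - Real.arccos Y),
    mul_le_mul (key (Real.arccos X + Real.arccos Y)).2 (key (Real.arccos X - Real.arccos Y)).2
      (key (Real.arccos X - Real.arccos Y)).1 (by norm_num : (0:ℝ) ≤ 4)]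

lemma abs_regLogKernel_le {ρ X Y : ℝ} (h0 : 0 ≤ ρ) (h1 : ρ ≤ 1)
    (hX : X ∈ Icc (-1 : ℝ) 1) (hY : Y ∈ Icc (-1 : ℝ) 1) (h : X ≠ Y) :
    |regLogKernel ρ X Y| ≤ |Real.log (|X - Y|)| + Real.log 4 := by
  have hpos : 0 < |X - Y| := abs_pos.2 (sub_ne_zero.2 h)
  have hl := sq_sub_div_four_le_regQuartic h0 hX hY
  have hu := regQuartic_le h0 h1 hX hY
  rw [← sq_abs] at hl
  have hq : 0 < regQuartic ρ X Y := lt_of_lt_of_le (by positivity) hl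
  have l1 := Real.log_le_log (by positivity) hl
  have l2 := Real.log_le_log hq hu
  rw [Real.log_div (by positivity) (by norm_num), Real.log_pow] at l1
  rw [show (16 : ℝ) = 4 ^ 2 by norm_num, Real.log_pow] at l2
  have l4 : 0 < Real.log 4 := Real.log_pos (by norm_num)
  push_cast at l1 l2
  unfold regLogKernel
  rw [abs_le]
  constructor <;> linarith [neg_abs_le (Real.log |X - Y|), abs_nonneg (Real.log |X - Y|)]

lemma tendsto_regLogKernel {X Y : ℝ} (h : X ≠ Y) :
    Tendsto (fun ρ => regLogKernel ρ X Y) (𝓝[<] 1) (𝓝 (Real.log (2 * |X - Y|))) := by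
  have e : Real.log (2 * |X - Y|) = regLogKernel 1 X Y := by
    have : regQuartic 1 X Y = (2 * |X - Y|) ^ 2 := by
      rw [mul_pow, sq_abs]; unfold regQuartic; ring
    rw [regLogKernel, this, Real.log_pow]; push_cast; ring
  rw [e]
  have hne : regQuartic 1 X Y ≠ 0 := by
    have : regQuartic 1 X Y = 4 * (X - Y) ^ 2 := by unfold regQuartic; ring
    rw [this]
    have := sub_ne_zero.2 h
    positivity
  have hc : ContinuousAt (fun ρ => regLogKernel ρ X Y) 1 := by
    unfold regLogKernel
    refine continuousAt_const.mul (ContinuousAt.log ?_ hne)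
    unfold regQuartic
    fun_prop
  exact hc.tendsto.mono_left nhdsWithin_le_nhds

lemma measurable_regLogKernel (ρ : ℝ) : Measurable fun p : ℝ × ℝ => regLogKernel ρ p.1 p.2 := by
  unfold regLogKernel regQuartic
  fun_prop

lemma tendsto_integral_regLogKernel {Ω : Type*} [MeasurableSpace Ω] {τ : Measure Ω}
    [IsFiniteMeasure τ] {f g : Ω → ℝ} (hf : Measurable f) (hg : Measurable g)
    (hf1 : ∀ᵐ ω ∂τ, f ω ∈ Icc (-1 : ℝ) 1) (hg1 : ∀ᵐ ω ∂τ, g ω ∈ Icc (-1 : ℝ) 1)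
    (hne : ∀ᵐ ω ∂τ, f ω ≠ g ω) (hint : Integrable (fun ω => Real.log |f ω - g ω|) τ) :
    Tendsto (fun ρ => ∫ ω, regLogKernel ρ (f ω) (g ω) ∂τ) (𝓝[<] 1)
      (𝓝 (∫ ω, Real.log (2 * |f ω - g ω|) ∂τ)) := by
  refine tendsto_integral_filter_of_dominated_convergence
    (fun ω => |Real.log (|f ω - g ω|)| + Real.log 4) ?_ ?_ (hint.abs.add (integrable_const _)) ?_
  · exact Eventually.of_forall fun ρ =>
      ((measurable_regLogKernel ρ).comp (hf.prodMk hg)).aestronglyMeasurable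
  · have : ∀ᶠ ρ : ℝ in 𝓝[<] 1, ρ ∈ Ioo (0 : ℝ) 1 := Ioo_mem_nhdsLT (by norm_num)
    filter_upwards [this] with ρ hρ
    filter_upwards [hf1, hg1, hne] with ω h1 h2 h3
    exact abs_regLogKernel_le hρ.1.le hρ.2.le h1 h2 h3
  · filter_upwards [hne] with ω h3 using tendsto_regLogKernel h3

/-- Real part of the Taylor series of `-log(1 - z)` at `z = ρ e^{it}`. The term `n = 0` is zero
because division by zero gives zero. -/
lemma hasSum_log_one_sub_cos {ρ : ℝ} (h0 : 0 ≤ ρ) (h1 : ρ < 1) (t : ℝ) :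
    HasSum (fun n : ℕ => ρ ^ n / n * Real.cos (n * t))
      (-(1 / 2 * Real.log (1 - 2 * ρ * Real.cos t + ρ ^ 2))) := by
  set z : ℂ := ρ * Complex.exp (t * Complex.I) with hz
  have hnz : ‖z‖ < 1 := by
    rw [hz, norm_mul, Complex.norm_exp_ofReal_mul_I, Complex.norm_real, Real.norm_eq_abs,
      abs_of_nonneg h0, mul_one]; exact h1
  have h := Complex.hasSum_re (Complex.hasSum_taylorSeries_neg_log hnz)
  convert h using 1
  · ext n
    rw [hz, mul_pow, ← Complex.exp_nat_mul, ← mul_assoc,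
      show ((n : ℂ) * t) = ((n * t : ℝ) : ℂ) by push_cast; ring, ← Complex.ofReal_pow,
      mul_div_right_comm, ← Complex.ofReal_natCast, ← Complex.ofReal_div, Complex.re_ofReal_mul,
      Complex.exp_ofReal_mul_I_re]
  · rw [Complex.neg_re, Complex.log_re]
    have : Complex.normSq (1 - z) = 1 - 2 * ρ * Real.cos t + ρ ^ 2 := by
      rw [Complex.normSq_apply, hz]
      simp only [Complex.sub_re, Complex.one_re, Complex.re_ofReal_mul, Complex.sub_im,
        Complex.one_im, Complex.im_ofReal_mul, Complex.exp_ofReal_mul_I_re,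
        Complex.exp_ofReal_mul_I_im]
      linear_combination ρ ^ 2 * Real.sin_sq_add_cos_sq t
    rw [← this, Complex.normSq_eq_norm_sq, Real.log_pow]
    push_cast; ring

lemma one_sub_cos_pos {ρ : ℝ} (h0 : 0 ≤ ρ) (h1 : ρ < 1) (t : ℝ) :
    0 < 1 - 2 * ρ * Real.cos t + ρ ^ 2 := by
  nlinarith [mul_le_mul_of_nonneg_left (Real.cos_le_one t) h0, sq_pos_of_pos (sub_pos.2 h1)]

lemma regLogKernel_cos {ρ : ℝ} (h0 : 0 ≤ ρ) (h1 : ρ < 1) (a b : ℝ) :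
    regLogKernel ρ (Real.cos a) (Real.cos b) =
      1 / 2 * Real.log (1 - 2 * ρ * Real.cos (a + b) + ρ ^ 2) +
        1 / 2 * Real.log (1 - 2 * ρ * Real.cos (a - b) + ρ ^ 2) := by
  rw [regLogKernel, regQuartic_cos, Real.log_mul (one_sub_cos_pos h0 h1 _).ne'
    (one_sub_cos_pos h0 h1 _).ne']
  ring

/-- Add the series at the angles `a + b` and `a - b` and use `cos n(a+b) + cos n(a-b) = 2 cos na cos
nb`. -/
lemma hasSum_regLogKernel {ρ X Y : ℝ} (h0 : 0 ≤ ρ) (h1 : ρ < 1)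
    (hX : X ∈ Icc (-1 : ℝ) 1) (hY : Y ∈ Icc (-1 : ℝ) 1) :
    HasSum (fun n : ℕ => 2 * (ρ ^ n / n) *
        ((Polynomial.Chebyshev.T ℝ n).eval X * (Polynomial.Chebyshev.T ℝ n).eval Y))
      (-regLogKernel ρ X Y) := by
  rw [← Real.cos_arccos hX.1 hX.2, ← Real.cos_arccos hY.1 hY.2]
  set a := Real.arccos X
  set b := Real.arccos Y
  have h := (hasSum_log_one_sub_cos h0 h1 (a + b)).add (hasSum_log_one_sub_cos h0 h1 (a - b))
  convert h using 1
  · ext n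
    rw [Polynomial.Chebyshev.T_real_cos, Polynomial.Chebyshev.T_real_cos, mul_add, mul_sub,
      Real.cos_add, Real.cos_sub]
    push_cast; ring
  · rw [regLogKernel_cos h0 h1]; ring

/-! ### The Poisson kernel and its logarithmic potential -/

/-- The Poisson kernel of the unit disc at radius `r` and angle `t`. -/
noncomputable def poissonDisc (r t : ℝ) : ℝ := (1 - r ^ 2) / (1 - 2 * r * Real.cos t + r ^ 2)

lemma continuous_poissonDisc {r : ℝ} (h0 : 0 ≤ r) (h1 : r < 1) : Continuous (poissonDisc r) := by
  unfold poissonDisc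
  exact continuous_const.div (by fun_prop) fun t => (one_sub_cos_pos h0 h1 t).ne'

lemma normSq_one_sub_mul_exp (r t : ℝ) :
    Complex.normSq (1 - r * Complex.exp (t * Complex.I)) = 1 - 2 * r * Real.cos t + r ^ 2 := by
  rw [Complex.normSq_apply]
  simp only [Complex.sub_re, Complex.one_re, Complex.re_ofReal_mul, Complex.sub_im,
    Complex.one_im, Complex.im_ofReal_mul, Complex.exp_ofReal_mul_I_re,
    Complex.exp_ofReal_mul_I_im]
  linear_combination r ^ 2 * Real.sin_sq_add_cos_sq t

lemma poissonKernel_circleMap (r t : ℝ) :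
    poissonKernel 0 (r : ℂ) (circleMap 0 1 t) = poissonDisc r t := by
  have e : ‖Complex.exp (t * Complex.I) - r‖ ^ 2 = 1 - 2 * r * Real.cos t + r ^ 2 := by
    rw [← Complex.normSq_eq_norm_sq, Complex.normSq_apply]
    simp only [Complex.sub_re, Complex.ofReal_re, Complex.sub_im,
      Complex.ofReal_im, Complex.exp_ofReal_mul_I_re, Complex.exp_ofReal_mul_I_im]
    linear_combination Real.sin_sq_add_cos_sq t
  rw [poissonKernel_def, poissonDisc, circleMap_zero]
  simp only [sub_zero, Complex.ofReal_one, one_mul]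
  rw [e, Complex.norm_exp_ofReal_mul_I, Complex.norm_real, Real.norm_eq_abs, sq_abs, one_pow]

lemma integral_mul_poissonDisc_of_diffContOnCl {r : ℝ} (h0 : 0 ≤ r) (h1 : r < 1) {g : ℂ → ℂ}
    (hg : DiffContOnCl ℂ g (Metric.ball 0 1)) {u : ℝ → ℝ} (hu : Continuous u)
    (hgu : ∀ t, (g (circleMap 0 1 t)).re = u t) (hsymm : ∀ t, u (2 * Real.pi - t) = u t) :
    ∫ t in (0 : ℝ)..Real.pi, u t * poissonDisc r t = Real.pi * (g r).re := by
  have hr : (r : ℂ) ∈ Metric.ball (0 : ℂ) 1 := by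
    simpa [abs_of_nonneg h0] using h1
  have h := congrArg Complex.re (hg.circleAverage_poissonKernel_smul hr)
  have hcont : Continuous fun t => g (circleMap 0 1 t) := by
    have hc := hg.continuousOn
    rw [closure_ball _ one_ne_zero] at hc
    exact hc.comp_continuous (continuous_circleMap 0 1) fun t =>
      Metric.sphere_subset_closedBall (circleMap_mem_sphere 0 zero_le_one t)
  have hP := continuous_poissonDisc h0 h1
  rw [Real.circleAverage_def, Complex.smul_re] at h
  simp only [Pi.smul_apply', poissonKernel_circleMap] at h
  have hi : IntervalIntegrable (fun t => poissonDisc r t • g (circleMap 0 1 t)) volume 0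
      (2 * Real.pi) := (hP.smul hcont).intervalIntegrable _ _
  have h2 := Complex.reCLM.intervalIntegral_comp_comm hi
  simp only [Complex.reCLM_apply, Complex.smul_re, hgu, smul_eq_mul] at h2 h
  rw [← h2] at h
  have hcu : Continuous fun t => poissonDisc r t * u t := hP.mul hu
  -- Both factors are symmetric under `t ↦ 2π - t`, so each half circle carries half of the Poisson
  -- integral.
  have hs : ∫ t in Real.pi..(2 * Real.pi), poissonDisc r t * u t =
      ∫ t in (0 : ℝ)..Real.pi, poissonDisc r t * u t := by
    have := intervalIntegral.integral_comp_sub_left (a := 0) (b := Real.pi)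
      (fun t => poissonDisc r t * u t) (2 * Real.pi)
    rw [sub_zero, show 2 * Real.pi - Real.pi = Real.pi by ring] at this
    rw [← this]
    refine intervalIntegral.integral_congr fun t _ => ?_
    simp only [hsymm, poissonDisc, Real.cos_two_pi_sub]
  rw [← intervalIntegral.integral_add_adjacent_intervals (hcu.intervalIntegrable 0 Real.pi)
    (hcu.intervalIntegrable Real.pi (2 * Real.pi)), hs] at h
  simp only [mul_comm (u _)]
  have := Real.pi_pos
  field_simp at h
  linarith

lemma integral_poissonDisc {r : ℝ} (h0 : 0 ≤ r) (h1 : r < 1) :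
    ∫ t in (0 : ℝ)..Real.pi, poissonDisc r t = Real.pi := by
  have := integral_mul_poissonDisc_of_diffContOnCl h0 h1 (g := fun _ => 1) (u := fun _ => 1)
    diffContOnCl_const continuous_const (by simp) (by simp)
  simpa using this

lemma log_normSq_re (z : ℂ) : (Complex.log z).re = 1 / 2 * Real.log (Complex.normSq z) := by
  rw [Complex.log_re, Complex.normSq_eq_norm_sq, Real.log_pow]
  push_cast; ring

lemma diffContOnCl_log_one_sub {c : ℂ} (hc : ‖c‖ < 1) :
    DiffContOnCl ℂ (fun z => Complex.log (1 - c * z)) (Metric.ball 0 1) := by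
  apply DifferentiableOn.diffContOnCl
  rw [closure_ball _ one_ne_zero]
  intro z hz
  rw [mem_closedBall_zero_iff] at hz
  refine (DifferentiableAt.clog (by fun_prop) ?_).differentiableWithinAt
  rw [sub_eq_add_neg]
  apply Complex.mem_slitPlane_of_norm_lt_one
  rw [norm_neg, norm_mul]
  nlinarith [norm_nonneg c, norm_nonneg z]

/-- On the unit circle the kernel is the real part of `log(1 - ρe^{ia}z) + log(1 - ρe^{-ia}z)`,
holomorphic near the closed disc since `ρ < 1`. Poisson's formula evaluates it at `z = r`, where the
two arguments are conjugate and contribute equally. -/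
lemma integral_regLogKernel_mul_poissonDisc {r ρ : ℝ} (h0 : 0 ≤ r) (h1 : r < 1) (k0 : 0 ≤ ρ)
    (k1 : ρ < 1) (a : ℝ) :
    ∫ t in (0 : ℝ)..Real.pi, regLogKernel ρ (Real.cos a) (Real.cos t) * poissonDisc r t =
      Real.pi * Real.log (1 - 2 * (ρ * r) * Real.cos a + (ρ * r) ^ 2) := by
  have hn : ∀ b : ℝ, ‖(ρ : ℂ) * Complex.exp (b * Complex.I)‖ < 1 := fun b => by
    rw [norm_mul, Complex.norm_exp_ofReal_mul_I, Complex.norm_real, Real.norm_eq_abs,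
      abs_of_nonneg k0, mul_one]; exact k1
  have key := integral_mul_poissonDisc_of_diffContOnCl h0 h1
    (g := fun z => Complex.log (1 - ρ * Complex.exp (a * Complex.I) * z) +
      Complex.log (1 - ρ * Complex.exp ((-a : ℝ) * Complex.I) * z))
    (u := fun t => regLogKernel ρ (Real.cos a) (Real.cos t))
    ((diffContOnCl_log_one_sub (hn a)).add (diffContOnCl_log_one_sub (hn (-a)))) ?_ ?_ ?_
  · rw [key, Complex.add_re, log_normSq_re, log_normSq_re]
    have e : ∀ b : ℝ, (ρ : ℂ) * Complex.exp (b * Complex.I) * r =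
        ((ρ * r : ℝ) : ℂ) * Complex.exp (b * Complex.I) := fun b => by push_cast; ring
    rw [e, e, normSq_one_sub_mul_exp, normSq_one_sub_mul_exp, Real.cos_neg]
    ring
  · simp only [regLogKernel_cos k0 k1]
    have : ∀ t : ℝ, 1 - 2 * ρ * Real.cos t + ρ ^ 2 ≠ 0 := fun t => (one_sub_cos_pos k0 k1 t).ne'
    exact (continuous_const.mul (Continuous.log (by fun_prop) fun t => this _)).add
      (continuous_const.mul (Continuous.log (by fun_prop) fun t => this _))
  · intro t
    have e : ∀ b : ℝ, (ρ : ℂ) * Complex.exp (b * Complex.I) * circleMap 0 1 t =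
        ρ * Complex.exp ((b + t : ℝ) * Complex.I) := fun b => by
      rw [circleMap_zero, Complex.ofReal_one, one_mul, mul_assoc, ← Complex.exp_add]
      push_cast; ring_nf
    rw [e, e, Complex.add_re, log_normSq_re, log_normSq_re, normSq_one_sub_mul_exp,
      normSq_one_sub_mul_exp, regLogKernel_cos k0 k1, show -a + t = -(a - t) by ring,
      Real.cos_neg]
  · intro t
    simp only [Real.cos_two_pi_sub]

lemma integrableOn_log_abs_cos_sub_cos (a : ℝ) :
    IntegrableOn (fun t => Real.log (|Real.cos a - Real.cos t|)) (Ioo 0 Real.pi) := by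
  have h : MeromorphicOn (fun t : ℝ => Real.cos a - Real.cos t) (uIcc 0 Real.pi) := by
    apply AnalyticOnNhd.meromorphicOn
    exact fun t _ => analyticAt_const.sub Real.analyticAt_cos
  have := (intervalIntegrable_iff_integrableOn_Ioo_of_le Real.pi_pos.le).1 h.intervalIntegrable_log
  simpa only [Real.log_abs, Function.comp_def] using this

lemma integral_log_mul_poissonDisc {r : ℝ} (h0 : 0 ≤ r) (h1 : r < 1) {a : ℝ}
    (ha : a ∈ Icc 0 Real.pi) :
    ∫ t in Ioo 0 Real.pi, Real.log (2 * |Real.cos a - Real.cos t|) * poissonDisc r t =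
      Real.pi * Real.log (1 - 2 * r * Real.cos a + r ^ 2) := by
  have hP := continuous_poissonDisc h0 h1
  have hP0 : ∀ t, 0 ≤ poissonDisc r t := fun t =>
    div_nonneg (by nlinarith) (one_sub_cos_pos h0 h1 t).le
  have hne : ∀ᵐ t ∂volume.restrict (Ioo 0 Real.pi), Real.cos a ≠ Real.cos t := by
    have h : ∀ᵐ t : ℝ ∂volume.restrict (Ioo 0 Real.pi), t ≠ a :=
      ae_restrict_of_ae (by simp [ae_iff])
    filter_upwards [h, ae_restrict_mem measurableSet_Ioo] with t h1 h2 h3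
    exact h1 (Real.injOn_cos ha (Ioo_subset_Icc_self h2) h3).symm
  obtain ⟨C, hC⟩ : ∃ C, ∀ t ∈ Icc 0 Real.pi, ‖poissonDisc r t‖ ≤ C :=
    isCompact_Icc.exists_bound_of_continuousOn hP.continuousOn
  have lim1 : Tendsto (fun ρ => ∫ t in Ioo 0 Real.pi,
      regLogKernel ρ (Real.cos a) (Real.cos t) * poissonDisc r t) (𝓝[<] 1)
      (𝓝 (∫ t in Ioo 0 Real.pi, Real.log (2 * |Real.cos a - Real.cos t|) * poissonDisc r t)) := by
    refine tendsto_integral_filter_of_dominated_convergence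
      (fun t => (|Real.log (|Real.cos a - Real.cos t|)| + Real.log 4) * C) ?_ ?_ ?_ ?_
    · refine Eventually.of_forall fun ρ => Measurable.aestronglyMeasurable ?_
      exact ((measurable_regLogKernel ρ).comp (measurable_const.prodMk Real.measurable_cos)).mul
        hP.measurable
    · have : ∀ᶠ ρ : ℝ in 𝓝[<] 1, ρ ∈ Ioo (0 : ℝ) 1 := Ioo_mem_nhdsLT (by norm_num)
      filter_upwards [this] with ρ hρ
      filter_upwards [hne, ae_restrict_mem measurableSet_Ioo] with t h3 ht
      rw [norm_mul, Real.norm_eq_abs (regLogKernel _ _ _)]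
      exact mul_le_mul (abs_regLogKernel_le hρ.1.le hρ.2.le (Real.cos_mem_Icc _)
        (Real.cos_mem_Icc _) h3) (hC t (Ioo_subset_Icc_self ht)) (norm_nonneg _)
        (add_nonneg (abs_nonneg _) (Real.log_nonneg (by norm_num)))
    · exact ((integrableOn_log_abs_cos_sub_cos a).abs.add (integrable_const _)).mul_const _
    · filter_upwards [hne] with t h3 using (tendsto_regLogKernel h3).mul_const _
  have lim2 : Tendsto (fun ρ => ∫ t in Ioo 0 Real.pi,
      regLogKernel ρ (Real.cos a) (Real.cos t) * poissonDisc r t) (𝓝[<] 1)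
      (𝓝 (Real.pi * Real.log (1 - 2 * r * Real.cos a + r ^ 2))) := by
    have hc : ContinuousAt (fun ρ : ℝ =>
        Real.pi * Real.log (1 - 2 * (ρ * r) * Real.cos a + (ρ * r) ^ 2)) 1 := by
      refine continuousAt_const.mul (ContinuousAt.log (by fun_prop) ?_)
      rw [one_mul]; exact (one_sub_cos_pos h0 h1 a).ne'
    have := hc.tendsto.mono_left (nhdsWithin_le_nhds (s := Iio 1))
    rw [one_mul] at this
    refine this.congr' ?_
    have : ∀ᶠ ρ : ℝ in 𝓝[<] 1, ρ ∈ Ioo (0 : ℝ) 1 := Ioo_mem_nhdsLT (by norm_num)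
    filter_upwards [this] with ρ hρ
    rw [← integral_regLogKernel_mul_poissonDisc h0 h1 hρ.1.le hρ.2 a,
      intervalIntegral.integral_of_le Real.pi_pos.le, integral_Ioc_eq_integral_Ioo]
  exact tendsto_nhds_unique lim1 lim2

/-! ### The arctangent term as a superposition of Poisson kernels -/

lemma integral_sq_div_sq_add_sq {S c : ℝ} (hS : 0 < S) :
    ∫ w in (0 : ℝ)..c, w ^ 2 / (w ^ 2 + S ^ 2) = c - S * Real.arctan (c / S) := by
  have hne : ∀ w : ℝ, w ^ 2 + S ^ 2 ≠ 0 := fun w => by positivity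
  rw [intervalIntegral.integral_eq_sub_of_hasDerivAt
    (f := fun w => w - S * Real.arctan (w / S))]
  · simp
  · intro w _
    refine ((hasDerivAt_id w).sub
      (((hasDerivAt_id w).div_const S).arctan.const_mul S)).congr_deriv ?_
    have := hne w
    have h2 : 1 + (w / S) ^ 2 ≠ 0 := by positivity
    simp only [id]
    field_simp
    ring
  · exact (Continuous.div (by fun_prop) (by fun_prop) hne).intervalIntegrable _ _

/-- The radius at which the Poisson kernel is the balayage of the point `1 + w²`. -/
noncomputable def poleRadius (w : ℝ) : ℝ := (√(1 + w ^ 2) - w) ^ 2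

lemma lt_sqrt_one_add_sq (w : ℝ) : w < √(1 + w ^ 2) :=
  lt_of_le_of_lt (le_abs_self w) (by
    rw [← Real.sqrt_sq_eq_abs]; exact Real.sqrt_lt_sqrt (sq_nonneg _) (by linarith))

lemma poleRadius_pos (w : ℝ) : 0 < poleRadius w :=
  pow_pos (sub_pos.2 (lt_sqrt_one_add_sq w)) 2

lemma continuous_poleRadius : Continuous poleRadius := by
  unfold poleRadius; fun_prop

lemma poleRadius_lt_one {w : ℝ} (hw : 0 < w) : poleRadius w < 1 := by
  have h1 := lt_sqrt_one_add_sq w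
  have h2 : √(1 + w ^ 2) < 1 + w := by
    rw [Real.sqrt_lt' (by linarith)]; nlinarith
  unfold poleRadius
  nlinarith

/-- With `w = sinh θ` the radius is `r = e^{-2θ}`. This identity is `1/r - r = 2 sinh 2θ`, and the
next one is `1/r + r = 2 cosh 2θ`, which says that `1 + w² = (1 + (r + 1/r)/2)/2`. -/
lemma one_sub_poleRadius_sq (w : ℝ) :
    1 - poleRadius w ^ 2 = poleRadius w * (4 * √(1 + w ^ 2) * w) := by
  have h : √(1 + w ^ 2) ^ 2 = 1 + w ^ 2 := Real.sq_sqrt (by positivity)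
  unfold poleRadius
  generalize √(1 + w ^ 2) = v at *
  have e : (v - w) * (v + w) = 1 := by linear_combination h
  have e2 : (v - w) ^ 2 * (v + w) ^ 2 = 1 := by rw [← mul_pow, e, one_pow]
  linear_combination -e2

lemma one_add_poleRadius_sq (w : ℝ) :
    1 + poleRadius w ^ 2 = poleRadius w * (2 + 4 * w ^ 2) := by
  have h : √(1 + w ^ 2) ^ 2 = 1 + w ^ 2 := Real.sq_sqrt (by positivity)
  unfold poleRadius
  generalize √(1 + w ^ 2) = v at *
  have e : (v - w) * (v + w) = 1 := by linear_combination h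
  have e2 : (v - w) ^ 2 * (v + w) ^ 2 = 1 := by rw [← mul_pow, e, one_pow]
  linear_combination (2 * (v - w) ^ 2) * h - e2

lemma cos_half_sq (t : ℝ) : Real.cos (t / 2) ^ 2 = (1 + Real.cos t) / 2 := by
  rw [Real.cos_sq, show 2 * (t / 2) = t by ring]; ring

lemma sq_div_sq_add_sin_sq {w : ℝ} (hw : 0 < w) (t : ℝ) :
    w ^ 2 / (w ^ 2 + Real.sin (t / 2) ^ 2) =
      w / √(1 + w ^ 2) * poissonDisc (poleRadius w) t := by
  have hs : Real.sin (t / 2) ^ 2 = (1 - Real.cos t) / 2 := by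
    have := cos_half_sq t
    have := Real.sin_sq_add_cos_sq (t / 2)
    linarith
  have hv : 0 < √(1 + w ^ 2) := Real.sqrt_pos.2 (by positivity)
  have hr := poleRadius_pos w
  have hd := one_sub_cos_pos hr.le (poleRadius_lt_one hw) t
  have h2 := one_add_poleRadius_sq w
  have h1 := one_sub_poleRadius_sq w
  have hc := Real.cos_le_one t
  rw [poissonDisc, hs, h1, show 1 - 2 * poleRadius w * Real.cos t + poleRadius w ^ 2 =
    poleRadius w * (2 * (2 * w ^ 2 + (1 - Real.cos t))) by linear_combination h2]
  have h3 : 2 * w ^ 2 + (1 - Real.cos t) ≠ 0 := by nlinarith [sq_pos_of_pos hw]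
  have h4 : w ^ 2 + (1 - Real.cos t) / 2 ≠ 0 := by nlinarith [sq_pos_of_pos hw]
  field_simp
  ring

lemma sin_half_pos {t : ℝ} (ht : t ∈ Ioo 0 Real.pi) : 0 < Real.sin (t / 2) :=
  Real.sin_pos_of_pos_of_lt_pi (by linarith [ht.1]) (by linarith [ht.2, Real.pi_pos])

lemma cos_half_pos {t : ℝ} (ht : t ∈ Ioo 0 Real.pi) : 0 < Real.cos (t / 2) :=
  Real.cos_pos_of_mem_Ioo ⟨by linarith [ht.1, Real.pi_pos], by linarith [ht.2]⟩

lemma integrable_mul_sq_div {f : ℝ → ℝ} (hf : IntegrableOn f (Ioo 0 Real.pi)) (c : ℝ) :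
    Integrable (fun z : ℝ × ℝ => f z.1 * (z.2 ^ 2 / (z.2 ^ 2 + Real.sin (z.1 / 2) ^ 2)))
      ((volume.restrict (Ioo 0 Real.pi)).prod (volume.restrict (Ioo 0 c))) := by
  have h1 : Integrable (fun z : ℝ × ℝ => f z.1)
      ((volume.restrict (Ioo 0 Real.pi)).prod (volume.restrict (Ioo 0 c))) := hf.comp_fst _
  refine h1.mul_bdd (c := 1) (Measurable.aestronglyMeasurable (by fun_prop)) ?_
  refine Eventually.of_forall fun z => ?_
  rw [Real.norm_eq_abs, abs_of_nonneg (by positivity)]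
  exact div_le_one_of_le₀ (by nlinarith [sq_nonneg (Real.sin (z.1 / 2))]) (by positivity)

/-- Fubini for `c - S arctan(c/S) = ∫₀ᶜ w²/(w² + S²) dw`, whose integrand is a multiple of a Poisson
kernel in `t`. Integrability in `w` also comes from Fubini, so a logarithmic singularity of `g` at
`w = 0` needs no separate treatment. -/
lemma integral_mul_sub_arctan {f : ℝ → ℝ} (hf : IntegrableOn f (Ioo 0 Real.pi)) {c : ℝ}
    (hc : 0 ≤ c) {g : ℝ → ℝ}
    (hg : ∀ w, 0 < w → ∫ t in Ioo 0 Real.pi, f t * poissonDisc (poleRadius w) t = Real.pi * g w) :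
    IntegrableOn (fun w => w / √(1 + w ^ 2) * g w) (Ioo 0 c) ∧
    ∫ t in Ioo 0 Real.pi, f t * (1 / Real.pi *
      (c - Real.sin (t / 2) * Real.arctan (c / Real.sin (t / 2)))) =
      ∫ w in (0 : ℝ)..c, w / √(1 + w ^ 2) * g w := by
  have hint := integrable_mul_sq_div hf c
  have inner : ∀ w ∈ Ioo 0 c, ∫ t in Ioo 0 Real.pi,
      f t * (w ^ 2 / (w ^ 2 + Real.sin (t / 2) ^ 2)) = Real.pi * (w / √(1 + w ^ 2) * g w) := by
    intro w hw
    simp only [sq_div_sq_add_sin_sq hw.1]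
    rw [show Real.pi * (w / √(1 + w ^ 2) * g w) = w / √(1 + w ^ 2) * (Real.pi * g w) by ring,
      ← hg w hw.1, ← integral_const_mul]
    exact integral_congr_ae (Eventually.of_forall fun t => by simp only; ring)
  have hpi := Real.pi_pos.ne'
  constructor
  · have h := (hint.integral_prod_right).const_mul (1 / Real.pi)
    refine h.congr ?_
    filter_upwards [ae_restrict_mem measurableSet_Ioo] with w hw
    rw [inner w hw]; field_simp
  · have h := integral_integral_swap
      (f := fun t w => f t * (w ^ 2 / (w ^ 2 + Real.sin (t / 2) ^ 2))) hint
    have h2 : ∫ w in Ioo 0 c, ∫ t in Ioo 0 Real.pi,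
        f t * (w ^ 2 / (w ^ 2 + Real.sin (t / 2) ^ 2)) =
        ∫ w in Ioo 0 c, Real.pi * (w / √(1 + w ^ 2) * g w) :=
      setIntegral_congr_fun measurableSet_Ioo inner
    have h3 : ∫ t in Ioo 0 Real.pi, ∫ w in Ioo 0 c,
        f t * (w ^ 2 / (w ^ 2 + Real.sin (t / 2) ^ 2)) =
        ∫ t in Ioo 0 Real.pi, Real.pi * (f t * (1 / Real.pi *
      (c - Real.sin (t / 2) * Real.arctan (c / Real.sin (t / 2))))) := by
      refine setIntegral_congr_fun measurableSet_Ioo fun t ht => ?_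
      rw [integral_const_mul, ← integral_Ioc_eq_integral_Ioo, ← intervalIntegral.integral_of_le hc,
        integral_sq_div_sq_add_sq (sin_half_pos ht)]
      field_simp
    rw [h2, h3, integral_const_mul, integral_const_mul] at h
    rw [intervalIntegral.integral_of_le hc, integral_Ioc_eq_integral_Ioo]
    exact mul_left_cancel₀ hpi h

lemma hasDerivAt_sqrt_one_add_sq (w : ℝ) :
    HasDerivAt (fun w : ℝ => √(1 + w ^ 2)) (w / √(1 + w ^ 2)) w := by
  have hw : 1 + w ^ 2 ≠ 0 := by positivity
  refine (((hasDerivAt_pow 2 w).const_add 1).sqrt hw).congr_deriv ?_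
  have : 0 < √(1 + w ^ 2) := Real.sqrt_pos.2 (by positivity)
  push_cast
  field_simp

lemma continuous_div_sqrt_one_add_sq : Continuous fun w : ℝ => w / √(1 + w ^ 2) :=
  continuous_id.div (by fun_prop) fun w => (Real.sqrt_pos.2 (by positivity)).ne'

lemma integral_div_sqrt_one_add_sq (c : ℝ) :
    ∫ w in (0 : ℝ)..c, w / √(1 + w ^ 2) = √(1 + c ^ 2) - 1 := by
  rw [intervalIntegral.integral_eq_sub_of_hasDerivAt (fun w _ => hasDerivAt_sqrt_one_add_sq w)
    (continuous_div_sqrt_one_add_sq.intervalIntegrable _ _)]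
  simp

/-! ### The primitive of `log |v² - x|` -/

/-- `(v - a) log (v - a) + (v + a) log (v + a) - 2 v`, an antiderivative of `log |v² - a²|`. -/
noncomputable def logSqAntideriv (a v : ℝ) : ℝ :=
  (v - a) * Real.log (v - a) + (v + a) * Real.log (v + a) - 2 * v

lemma continuous_logSqAntideriv (a : ℝ) : Continuous (logSqAntideriv a) := by
  unfold logSqAntideriv
  exact ((Real.continuous_mul_log.comp (by fun_prop : Continuous fun v : ℝ => v - a)).add
    (Real.continuous_mul_log.comp (by fun_prop : Continuous fun v : ℝ => v + a))).sub (by fun_prop)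

/-- As `Real.log` ignores signs, the formula holds on both sides of `v = a`. -/
lemma hasDerivAt_logSqAntideriv {a v : ℝ} (h1 : v - a ≠ 0) (h2 : v + a ≠ 0) :
    HasDerivAt (logSqAntideriv a) (Real.log (v ^ 2 - a ^ 2)) v := by
  have d1 := (Real.hasDerivAt_mul_log h1).comp v ((hasDerivAt_id v).sub_const a)
  have d2 := (Real.hasDerivAt_mul_log h2).comp v ((hasDerivAt_id v).add_const a)
  rw [show v ^ 2 - a ^ 2 = (v - a) * (v + a) by ring, Real.log_mul h1 h2]
  refine ((d1.add d2).sub ((hasDerivAt_id v).const_mul 2)).congr_deriv ?_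
  ring

/-- Substitute `v = √(1 + w²)`, so `dv = w/√(1 + w²) dw`. Continuity of the primitive covers the
singular endpoint `w = 0` when `x = 1`. -/
lemma integral_div_sqrt_mul_log {x c : ℝ} (hx : x ∈ Icc (0 : ℝ) 1) (hc : 0 ≤ c)
    (hint : IntegrableOn (fun w => w / √(1 + w ^ 2) * Real.log (1 + w ^ 2 - x)) (Ioo 0 c)) :
    ∫ w in (0 : ℝ)..c, w / √(1 + w ^ 2) * Real.log (1 + w ^ 2 - x) =
      logSqAntideriv √x √(1 + c ^ 2) - logSqAntideriv √x 1 := by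
  have hx1 : √x ≤ 1 := Real.sqrt_le_one.2 hx.2
  rw [intervalIntegral.integral_eq_sub_of_hasDerivAt_of_le hc
    (f := fun w => logSqAntideriv √x √(1 + w ^ 2))]
  · simp
  · exact ((continuous_logSqAntideriv _).comp (by fun_prop)).continuousOn
  · intro w hw
    have h1 : 1 < √(1 + w ^ 2) := by
      rw [Real.lt_sqrt (by norm_num)]; nlinarith [hw.1]
    have h := (hasDerivAt_logSqAntideriv (a := √x) (v := √(1 + w ^ 2)) (by linarith)
      (by linarith [Real.sqrt_nonneg x])).comp w (hasDerivAt_sqrt_one_add_sq w)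
    rw [Real.sq_sqrt hx.1, Real.sq_sqrt (by positivity)] at h
    rw [mul_comm]
    exact h
  · exact (intervalIntegrable_iff_integrableOn_Ioo_of_le hc).2 hint

lemma integral_log_mul_sin_half {x : ℝ} (hx : 0 ≤ x)
    (hint : IntegrableOn (fun t => Real.log (|x - (1 + Real.cos t) / 2|)) (Ioo 0 Real.pi)) :
    ∫ t in Ioo 0 Real.pi, Real.log (|x - (1 + Real.cos t) / 2|) * (Real.sin (t / 2) / 2) =
      logSqAntideriv √x 1 := by
  have e := integral_eq_of_hasDerivAt_off_countable_of_le
    (fun t => -logSqAntideriv √x (Real.cos (t / 2)))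
    (fun t => Real.log (|x - (1 + Real.cos t) / 2|) * (Real.sin (t / 2) / 2)) Real.pi_pos.le
    -- Here `v = cos(t/2)`, and this is the only `t` at which `v = √x` can occur.
    (s := {2 * Real.arccos √x}) (countable_singleton _)
    (((continuous_logSqAntideriv _).comp (by fun_prop)).neg).continuousOn ?_ ?_
  · rw [← integral_Ioc_eq_integral_Ioo, ← intervalIntegral.integral_of_le Real.pi_pos.le, e]
    -- The primitive vanishes at `v = cos(π/2) = 0`, where the two logarithmic terms cancel.
    simp [logSqAntideriv]
  · rintro t ⟨ht, hne⟩
    have hcp := cos_half_pos ht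
    have hne' : Real.cos (t / 2) - √x ≠ 0 := by
      intro h
      apply hne
      rw [mem_singleton_iff, ← sub_eq_zero.1 h, Real.arccos_cos (by linarith [ht.1])
        (by linarith [ht.2, Real.pi_pos])]
      ring
    have hadd : Real.cos (t / 2) + √x ≠ 0 := by linarith [Real.sqrt_nonneg x]
    refine ((hasDerivAt_logSqAntideriv hne' hadd).comp t
      ((Real.hasDerivAt_cos (t / 2)).comp t ((hasDerivAt_id t).div_const 2))).neg.congr_deriv ?_
    rw [Real.sq_sqrt hx, cos_half_sq, Real.log_abs, ← Real.log_neg_eq_log, neg_sub]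
    ring
  · rw [intervalIntegrable_iff_integrableOn_Ioo_of_le Real.pi_pos.le]
    refine Integrable.mul_bdd (c := 1) hint (Measurable.aestronglyMeasurable (by fun_prop)) ?_
    refine Eventually.of_forall fun t => ?_
    rw [norm_div, Real.norm_eq_abs, Real.norm_two]
    linarith [Real.abs_sin_le_one (t / 2)]

/-! ### Mass and potential in the angular variable -/

/-- The density of the equilibrium measure with respect to `dt`, where `s = (1 + cos t) / 2`. -/
noncomputable def angularDensity (γ t : ℝ) : ℝ :=
  1 / √γ * (Real.sin (t / 2) / 2 + 1 / Real.pi *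
    (√(γ - 1) - Real.sin (t / 2) * Real.arctan (√(γ - 1) / Real.sin (t / 2))))

lemma measurable_sub_arctan (c : ℝ) : Measurable fun t =>
    1 / Real.pi * (c - Real.sin (t / 2) * Real.arctan (c / Real.sin (t / 2))) :=
  measurable_const.mul (measurable_const.sub ((by fun_prop : Measurable fun t : ℝ =>
    Real.sin (t / 2)).mul (Real.continuous_arctan.measurable.comp (by fun_prop))))

lemma norm_sub_arctan_le (c t : ℝ) :
    ‖1 / Real.pi * (c - Real.sin (t / 2) * Real.arctan (c / Real.sin (t / 2)))‖ ≤
      1 / Real.pi * (|c| + 1 * (Real.pi / 2)) := by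
  have h1 := Real.abs_sin_le_one (t / 2)
  have h2 : |Real.arctan (c / Real.sin (t / 2))| ≤ Real.pi / 2 := abs_le.2
    ⟨(Real.neg_pi_div_two_lt_arctan _).le, (Real.arctan_lt_pi_div_two _).le⟩
  rw [norm_mul, Real.norm_eq_abs, Real.norm_eq_abs, abs_of_nonneg (by positivity)]
  gcongr
  refine (abs_sub _ _).trans ?_
  rw [abs_mul]
  gcongr

lemma integrableOn_mul_sin_half {f : ℝ → ℝ} (hf : IntegrableOn f (Ioo 0 Real.pi)) :
    IntegrableOn (fun t => f t * (Real.sin (t / 2) / 2)) (Ioo 0 Real.pi) := by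
  refine Integrable.mul_bdd (c := 1) hf (Measurable.aestronglyMeasurable (by fun_prop)) ?_
  refine Eventually.of_forall fun t => ?_
  rw [norm_div, Real.norm_eq_abs, Real.norm_two]
  linarith [Real.abs_sin_le_one (t / 2)]

lemma integrableOn_mul_sub_arctan {f : ℝ → ℝ} (hf : IntegrableOn f (Ioo 0 Real.pi)) (c : ℝ) :
    IntegrableOn (fun t => f t * (1 / Real.pi *
      (c - Real.sin (t / 2) * Real.arctan (c / Real.sin (t / 2))))) (Ioo 0 Real.pi) :=
  Integrable.mul_bdd hf (measurable_sub_arctan c).aestronglyMeasurable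
    (Eventually.of_forall (norm_sub_arctan_le c))

lemma integrableOn_mul_angularDensity {f : ℝ → ℝ} (hf : IntegrableOn f (Ioo 0 Real.pi)) (γ : ℝ) :
    IntegrableOn (fun t => f t * angularDensity γ t) (Ioo 0 Real.pi) := by
  refine (((integrableOn_mul_sin_half hf).add
    (integrableOn_mul_sub_arctan hf √(γ - 1))).const_mul (1 / √γ)).congr
    (Eventually.of_forall fun t => ?_)
  simp only [angularDensity, Pi.add_apply]
  ring

lemma integral_mul_angularDensity {f : ℝ → ℝ} (hf : IntegrableOn f (Ioo 0 Real.pi)) (γ : ℝ) :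
    ∫ t in Ioo 0 Real.pi, f t * angularDensity γ t = 1 / √γ *
      ((∫ t in Ioo 0 Real.pi, f t * (Real.sin (t / 2) / 2)) +
        ∫ t in Ioo 0 Real.pi, f t * (1 / Real.pi *
          (√(γ - 1) - Real.sin (t / 2) * Real.arctan (√(γ - 1) / Real.sin (t / 2))))) := by
  rw [← integral_add (integrableOn_mul_sin_half hf) (integrableOn_mul_sub_arctan hf _),
    ← integral_const_mul]
  refine integral_congr_ae (Eventually.of_forall fun t => ?_)
  simp only [angularDensity]
  ring

lemma sqrt_one_add_sqrt_sub_one_sq {γ : ℝ} (hγ : 1 < γ) : √(1 + √(γ - 1) ^ 2) = √γ := by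
  rw [Real.sq_sqrt (by linarith)]; ring_nf

lemma setIntegral_poissonDisc {r : ℝ} (h0 : 0 ≤ r) (h1 : r < 1) :
    ∫ t in Ioo 0 Real.pi, poissonDisc r t = Real.pi := by
  rw [← integral_Ioc_eq_integral_Ioo, ← intervalIntegral.integral_of_le Real.pi_pos.le,
    integral_poissonDisc h0 h1]

lemma integral_angularDensity {γ : ℝ} (hγ : 1 < γ) :
    ∫ t in Ioo 0 Real.pi, angularDensity γ t = 1 := by
  have hf : IntegrableOn (fun _ : ℝ => (1 : ℝ)) (Ioo 0 Real.pi) := integrable_const _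
  have h := integral_mul_angularDensity hf γ
  have hP : ∀ w : ℝ, 0 < w → ∫ t in Ioo 0 Real.pi, 1 * poissonDisc (poleRadius w) t =
      Real.pi * 1 := fun w hw => by
    simpa using setIntegral_poissonDisc (poleRadius_pos w).le (poleRadius_lt_one hw)
  have h1 := (integral_mul_sub_arctan hf (Real.sqrt_nonneg (γ - 1)) (g := fun _ => 1) hP).2
  have h2 : ∫ t in Ioo 0 Real.pi, (1 : ℝ) * (Real.sin (t / 2) / 2) = 1 := by
    rw [← integral_Ioc_eq_integral_Ioo, ← intervalIntegral.integral_of_le Real.pi_pos.le,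
      intervalIntegral.integral_eq_sub_of_hasDerivAt (f := fun t => -Real.cos (t / 2))]
    · simp
    · intro t _
      refine ((Real.hasDerivAt_cos (t / 2)).comp t
        ((hasDerivAt_id t).div_const 2)).neg.congr_deriv ?_
      ring
    · exact Continuous.intervalIntegrable (by fun_prop) _ _
  simp only [mul_one, integral_div_sqrt_one_add_sq, sqrt_one_add_sqrt_sub_one_sq hγ] at h1
  rw [h1, h2] at h
  simp only [one_mul] at h
  rw [h]
  have : 0 < √γ := Real.sqrt_pos.2 (by linarith)
  field_simp
  ring

lemma integrableOn_log_sub_cos (a : ℝ) :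
    IntegrableOn (fun t => Real.log (|(1 + Real.cos a) / 2 - (1 + Real.cos t) / 2|))
      (Ioo 0 Real.pi) := by
  have h : MeromorphicOn (fun t : ℝ => (1 + Real.cos a) / 2 - (1 + Real.cos t) / 2)
      (uIcc 0 Real.pi) := by
    apply AnalyticOnNhd.meromorphicOn
    exact fun t _ => analyticAt_const.sub
      ((analyticAt_const.add Real.analyticAt_cos).div analyticAt_const two_ne_zero)
  have := (intervalIntegrable_iff_integrableOn_Ioo_of_le Real.pi_pos.le).1 h.intervalIntegrable_log
  simpa only [Real.log_abs, Function.comp_def] using this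

/-- The balayage property: up to the factor `π`, the potential on `[0,1]` is that of a unit mass at
`1 + w²` plus `log r`, which does not depend on `a`. -/
lemma integral_log_sub_cos_mul_poissonDisc {a : ℝ} (ha : a ∈ Icc 0 Real.pi) {w : ℝ} (hw : 0 < w) :
    ∫ t in Ioo 0 Real.pi, Real.log (|(1 + Real.cos a) / 2 - (1 + Real.cos t) / 2|) *
      poissonDisc (poleRadius w) t = Real.pi * (Real.log (poleRadius w) +
        Real.log (1 + w ^ 2 - (1 + Real.cos a) / 2)) := by
  have hr := poleRadius_pos w
  have hr1 := poleRadius_lt_one hw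
  have hP := continuous_poissonDisc hr.le hr1
  have hPi : IntegrableOn (poissonDisc (poleRadius w)) (Ioo 0 Real.pi) :=
    (hP.integrableOn_Icc).mono_set Ioo_subset_Icc_self
  obtain ⟨C, hC⟩ := isCompact_Icc.exists_bound_of_continuousOn (s := Icc 0 Real.pi)
    hP.continuousOn
  have hfP : IntegrableOn (fun t => Real.log (|(1 + Real.cos a) / 2 - (1 + Real.cos t) / 2|) *
      poissonDisc (poleRadius w) t) (Ioo 0 Real.pi) :=
    Integrable.mul_bdd (integrableOn_log_sub_cos a) hP.aestronglyMeasurable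
      ((ae_restrict_mem measurableSet_Ioo).mono fun t ht => hC t (Ioo_subset_Icc_self ht))
  have hne : ∀ᵐ t ∂volume.restrict (Ioo 0 Real.pi), Real.cos a ≠ Real.cos t := by
    have h : ∀ᵐ t : ℝ ∂volume.restrict (Ioo 0 Real.pi), t ≠ a :=
      ae_restrict_of_ae (by simp [ae_iff])
    filter_upwards [h, ae_restrict_mem measurableSet_Ioo] with t h1 h2 h3
    exact h1 (Real.injOn_cos ha (Ioo_subset_Icc_self h2) h3).symm
  have h1 := integral_log_mul_poissonDisc hr.le hr1 ha
  have h2 : ∫ t in Ioo 0 Real.pi, Real.log (2 * |Real.cos a - Real.cos t|) *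
      poissonDisc (poleRadius w) t = ∫ t in Ioo 0 Real.pi,
      (Real.log 4 * poissonDisc (poleRadius w) t +
        Real.log (|(1 + Real.cos a) / 2 - (1 + Real.cos t) / 2|) *
          poissonDisc (poleRadius w) t) := by
    refine integral_congr_ae ?_
    filter_upwards [hne] with t ht
    have h3 : |Real.cos a - Real.cos t| ≠ 0 := abs_ne_zero.2 (sub_ne_zero.2 ht)
    rw [show (1 + Real.cos a) / 2 - (1 + Real.cos t) / 2 = (Real.cos a - Real.cos t) / 2 by ring,
      abs_div, abs_two, Real.log_div h3 two_ne_zero, Real.log_mul two_ne_zero h3,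
      show (4 : ℝ) = 2 ^ 2 by norm_num, Real.log_pow]
    push_cast
    ring
  rw [h2, integral_add (hPi.const_mul _) hfP, integral_const_mul,
    setIntegral_poissonDisc hr.le hr1] at h1
  have h5 : 0 < 1 + w ^ 2 - (1 + Real.cos a) / 2 := by nlinarith [Real.cos_le_one a]
  rw [show 1 - 2 * poleRadius w * Real.cos a + poleRadius w ^ 2 =
    4 * (poleRadius w * (1 + w ^ 2 - (1 + Real.cos a) / 2)) by
      linear_combination one_add_poleRadius_sq w, Real.log_mul (by norm_num) (by positivity),
    Real.log_mul hr.ne' h5.ne'] at h1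
  linarith

/-- Factor `√γ` out of both logarithms and put `u = √x/√γ`. -/
lemma logSqAntideriv_sqrt {γ x : ℝ} (hγ : 1 < γ) (hx : x ∈ Icc (0 : ℝ) 1) :
    1 / √γ * logSqAntideriv √x √γ =
      besselFieldScaled γ x / 2 + (2 * Real.log √γ - 2) := by
  have hg : 0 < √γ := Real.sqrt_pos.2 (by linarith)
  have ha : √x < √γ := Real.sqrt_lt_sqrt hx.1 (by linarith [hx.2])
  have h0 := Real.sqrt_nonneg x
  have hu : √x / √γ < 1 := (div_lt_one hg).2 ha
  have hu0 : 0 ≤ √x / √γ := by positivity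
  rw [besselFieldScaled, besselField, Real.sqrt_div hx.1, logSqAntideriv,
    show √γ - √x = √γ * (1 - √x / √γ) by field_simp,
    show √γ + √x = √γ * (1 + √x / √γ) by field_simp,
    Real.log_mul hg.ne' (by linarith), Real.log_mul hg.ne' (by linarith)]
  generalize √x / √γ = u at *
  field_simp
  ring

lemma exists_integral_log_mul_angularDensity {γ : ℝ} (hγ : 1 < γ) :
    ∃ C : ℝ, ∀ a ∈ Icc 0 Real.pi,
      ∫ t in Ioo 0 Real.pi, Real.log (|(1 + Real.cos a) / 2 - (1 + Real.cos t) / 2|) *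
        angularDensity γ t = besselFieldScaled γ ((1 + Real.cos a) / 2) / 2 + C := by
  refine ⟨1 / √γ * (∫ w in (0 : ℝ)..√(γ - 1), w / √(1 + w ^ 2) * Real.log (poleRadius w)) +
    (2 * Real.log √γ - 2), fun a ha => ?_⟩
  have hx : (1 + Real.cos a) / 2 ∈ Icc (0 : ℝ) 1 :=
    ⟨by linarith [Real.neg_one_le_cos a], by linarith [Real.cos_le_one a]⟩
  have hc := Real.sqrt_nonneg (γ - 1)
  obtain ⟨hi, he⟩ := integral_mul_sub_arctan (integrableOn_log_sub_cos a) hc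
    fun w hw => integral_log_sub_cos_mul_poissonDisc ha hw
  have hcont : Continuous fun w : ℝ => w / √(1 + w ^ 2) * Real.log (poleRadius w) :=
    continuous_div_sqrt_one_add_sq.mul
      (continuous_poleRadius.log fun w => (poleRadius_pos w).ne')
  have hk : IntegrableOn (fun w => w / √(1 + w ^ 2) * Real.log (poleRadius w))
      (Ioo 0 √(γ - 1)) := hcont.integrableOn_Icc.mono_set Ioo_subset_Icc_self
  have hl : IntegrableOn (fun w => w / √(1 + w ^ 2) *
      Real.log (1 + w ^ 2 - (1 + Real.cos a) / 2)) (Ioo 0 √(γ - 1)) :=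
    (hi.sub hk).congr (Eventually.of_forall fun w => by simp only [Pi.sub_apply]; ring)
  simp only [mul_add] at he
  rw [intervalIntegral.integral_add
    ((intervalIntegrable_iff_integrableOn_Ioo_of_le hc).2 hk)
    ((intervalIntegrable_iff_integrableOn_Ioo_of_le hc).2 hl),
    integral_div_sqrt_mul_log hx hc hl, sqrt_one_add_sqrt_sub_one_sq hγ] at he
  rw [integral_mul_angularDensity (integrableOn_log_sub_cos a), he,
    integral_log_mul_sin_half hx.1 (integrableOn_log_sub_cos a)]
  -- The part on `[0,1]` contributes `logSqAntideriv √x 1`, which cancels the lower limit of the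
  -- swept part; only the value at `√γ` remains.
  linear_combination logSqAntideriv_sqrt hγ hx

/-! ### Return to `[0,1]`: the measure solves the equilibrium problem -/

lemma image_cos_Ioo : (fun t : ℝ => (1 + Real.cos t) / 2) '' Ioo 0 Real.pi = Ioo 0 1 := by
  ext s
  constructor
  · rintro ⟨t, ht, rfl⟩
    have h1 : Real.cos t < 1 := by
      rw [← Real.cos_zero]
      exact Real.strictAntiOn_cos (left_mem_Icc.2 Real.pi_pos.le) (Ioo_subset_Icc_self ht) ht.1
    have h2 : -1 < Real.cos t := by
      rw [← Real.cos_pi]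
      exact Real.strictAntiOn_cos (Ioo_subset_Icc_self ht) (right_mem_Icc.2 Real.pi_pos.le) ht.2
    constructor <;> simp only <;> linarith
  · intro hs
    refine ⟨Real.arccos (2 * s - 1), ⟨Real.arccos_pos.2 (by linarith [hs.2]), ?_⟩, ?_⟩
    · refine lt_of_le_of_ne (Real.arccos_le_pi _) fun h => ?_
      have := Real.arccos_eq_pi.1 h
      linarith [hs.1]
    · simp only
      rw [Real.cos_arccos (by linarith [hs.1]) (by linarith [hs.2])]
      ring

lemma injOn_one_add_cos : InjOn (fun t : ℝ => (1 + Real.cos t) / 2) (Ioo 0 Real.pi) :=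
  fun t ht u hu h => Real.injOn_cos (Ioo_subset_Icc_self ht) (Ioo_subset_Icc_self hu)
    (by simp only at h; linarith)

lemma hasDerivWithinAt_one_add_cos (s : Set ℝ) (t : ℝ) :
    HasDerivWithinAt (fun t : ℝ => (1 + Real.cos t) / 2) (-Real.sin t / 2) s t :=
  (((Real.hasDerivAt_cos t).const_add 1).div_const 2).hasDerivWithinAt

lemma equilibriumDensity_mul_sin {γ t : ℝ} (hγ : 1 < γ) (ht : t ∈ Ioo 0 Real.pi) :
    |-Real.sin t / 2| * equilibriumDensity γ ((1 + Real.cos t) / 2) = angularDensity γ t := by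
  have hs := sin_half_pos ht
  have hc := cos_half_pos ht
  have hg : 0 < √γ := Real.sqrt_pos.2 (by linarith)
  have e1 : |-Real.sin t / 2| = Real.sin (t / 2) * Real.cos (t / 2) := by
    have := Real.sin_two_mul (t / 2)
    rw [show 2 * (t / 2) = t by ring] at this
    rw [this, show -(2 * Real.sin (t / 2) * Real.cos (t / 2)) / 2 =
      -(Real.sin (t / 2) * Real.cos (t / 2)) by ring, abs_neg, abs_of_pos (mul_pos hs hc)]
  have e2 : √(γ * ((1 + Real.cos t) / 2)) = √γ * Real.cos (t / 2) := by
    rw [← cos_half_sq, Real.sqrt_mul (by linarith), Real.sqrt_sq hc.le]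
  have e3 : √((γ - 1) / (1 - (1 + Real.cos t) / 2)) = √(γ - 1) / Real.sin (t / 2) := by
    rw [← cos_half_sq, ← Real.sin_sq, Real.sqrt_div (by linarith), Real.sqrt_sq hs.le]
  rw [equilibriumDensity, e1, e2, e3, angularDensity]
  generalize Real.arctan _ = A
  have := Real.pi_pos
  field_simp
  ring

/-- The measure on `(0, 1)` with density `equilibriumDensity γ`. -/
noncomputable def densityMeasure (γ : ℝ) : Measure ℝ :=
  (volume.restrict (Ioo (0 : ℝ) 1)).withDensity fun s => ENNReal.ofReal (equilibriumDensity γ s)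

lemma measurable_equilibriumDensity (γ : ℝ) : Measurable (equilibriumDensity γ) := by
  unfold equilibriumDensity
  exact (by fun_prop : Measurable fun s : ℝ => 1 / √(γ * s)).mul
    ((by fun_prop : Measurable fun s : ℝ => 1 / 2 + 1 / Real.pi * √((γ - 1) / (1 - s))).sub
      (measurable_const.mul (Real.continuous_arctan.measurable.comp (by fun_prop))))

lemma arctan_le_self {y : ℝ} (hy : 0 ≤ y) : Real.arctan y ≤ y := by
  rcases lt_or_ge (Real.arctan y) (Real.pi / 2) with h | h
  · have := Real.le_tan (Real.arctan_nonneg.2 hy) h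
    rwa [Real.tan_arctan] at this
  · exact absurd (Real.arctan_lt_pi_div_two y) (not_lt.2 h)

lemma equilibriumDensity_pos {γ s : ℝ} (hγ : 1 < γ) (hs : s ∈ Ioo (0 : ℝ) 1) :
    0 < equilibriumDensity γ s := by
  have h1 : 0 < √(γ * s) := Real.sqrt_pos.2 (mul_pos (by linarith) hs.1)
  have h2 := arctan_le_self (Real.sqrt_nonneg ((γ - 1) / (1 - s)))
  have h3 : 1 / Real.pi * Real.arctan √((γ - 1) / (1 - s)) ≤
      1 / Real.pi * √((γ - 1) / (1 - s)) := by
    have := Real.pi_pos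
    gcongr
  unfold equilibriumDensity
  exact mul_pos (by positivity) (by linarith)

lemma toReal_smul_density_ae {γ : ℝ} (hγ : 1 < γ) (F : ℝ → ℝ) :
    (fun s => (ENNReal.ofReal (equilibriumDensity γ s)).toReal • F s)
      =ᵐ[volume.restrict (Ioo (0 : ℝ) 1)] fun s => equilibriumDensity γ s * F s := by
  filter_upwards [ae_restrict_mem measurableSet_Ioo] with s hs
  rw [ENNReal.toReal_ofReal (equilibriumDensity_pos hγ hs).le, smul_eq_mul]

lemma integrable_densityMeasure_iff {γ : ℝ} (hγ : 1 < γ) (F : ℝ → ℝ) :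
    Integrable F (densityMeasure γ) ↔
      IntegrableOn (fun t => F ((1 + Real.cos t) / 2) * angularDensity γ t) (Ioo 0 Real.pi) := by
  rw [densityMeasure, integrable_withDensity_iff_integrable_smul'
    (measurable_equilibriumDensity γ).ennreal_ofReal (Eventually.of_forall fun _ =>
      ENNReal.ofReal_lt_top), integrable_congr (toReal_smul_density_ae hγ F), ← IntegrableOn,
    ← image_cos_Ioo, integrableOn_image_iff_integrableOn_abs_deriv_smul measurableSet_Ioo
      (fun t _ => hasDerivWithinAt_one_add_cos _ t) injOn_one_add_cos]
  refine integrableOn_congr_fun (fun t ht => ?_) measurableSet_Ioo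
  simp only [smul_eq_mul]
  rw [← mul_assoc, equilibriumDensity_mul_sin hγ ht, mul_comm]

lemma integral_densityMeasure {γ : ℝ} (hγ : 1 < γ) (F : ℝ → ℝ) :
    ∫ s, F s ∂densityMeasure γ =
      ∫ t in Ioo 0 Real.pi, F ((1 + Real.cos t) / 2) * angularDensity γ t := by
  rw [densityMeasure, integral_withDensity_eq_integral_toReal_smul
    (measurable_equilibriumDensity γ).ennreal_ofReal (Eventually.of_forall fun _ =>
      ENNReal.ofReal_lt_top), integral_congr_ae (toReal_smul_density_ae hγ F),
    ← image_cos_Ioo, integral_image_eq_integral_abs_deriv_smul measurableSet_Ioo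
      (fun t _ => hasDerivWithinAt_one_add_cos _ t) injOn_one_add_cos]
  refine setIntegral_congr_fun measurableSet_Ioo fun t ht => ?_
  simp only [smul_eq_mul]
  rw [← mul_assoc, equilibriumDensity_mul_sin hγ ht, mul_comm]

lemma isProbabilityMeasure_densityMeasure {γ : ℝ} (hγ : 1 < γ) :
    IsProbabilityMeasure (densityMeasure γ) := by
  have hi : Integrable (fun _ => (1 : ℝ)) (densityMeasure γ) := by
    rw [integrable_densityMeasure_iff hγ]
    exact integrableOn_mul_angularDensity (f := fun _ => 1) (integrable_const _) γ
  have hfin : IsFiniteMeasure (densityMeasure γ) := by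
    rcases (integrable_const_iff).1 hi with h | h
    · norm_num at h
    · exact h
  have h := integral_densityMeasure hγ fun _ => 1
  simp only [one_mul, integral_angularDensity hγ, integral_const, smul_eq_mul, mul_one] at h
  constructor
  rw [← ENNReal.toReal_eq_one_iff]
  exact h

lemma densityMeasure_singleton (γ x : ℝ) : densityMeasure γ {x} = 0 :=
  withDensity_absolutelyContinuous _ _ (by simp)

lemma support_densityMeasure {γ : ℝ} (hγ : 1 < γ) : (densityMeasure γ).support = Icc 0 1 := by
  apply Subset.antisymm
  · refine Measure.support_subset_of_isClosed isClosed_Icc ?_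
    refine (withDensity_absolutelyContinuous _ _).ae_le ?_
    exact (ae_restrict_mem measurableSet_Ioo).mono fun s hs => Ioo_subset_Icc_self hs
  · rw [← closure_Ioo (zero_ne_one' ℝ)]
    refine closure_minimal (fun x hx => ?_) Measure.isClosed_support
    rw [Measure.mem_support_iff_forall]
    intro U hU
    by_contra hcon
    have h0 : densityMeasure γ U = 0 := le_antisymm (not_lt.1 hcon) zero_le
    rw [densityMeasure, withDensity_apply_eq_zero
      (measurable_equilibriumDensity γ).ennreal_ofReal] at h0
    have hV : U ∩ Ioo 0 1 ∈ 𝓝 x := inter_mem hU (Ioo_mem_nhds hx.1 hx.2)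
    refine (Measure.measure_pos_of_mem_nhds volume hV).ne' ?_
    have h1 := (Measure.restrict_apply_eq_zero' measurableSet_Ioo).1 h0
    refine measure_mono_null (fun y hy => ?_) h1
    exact ⟨⟨(ENNReal.ofReal_pos.2 (equilibriumDensity_pos hγ hy.2)).ne', hy.1⟩, hy.2⟩

lemma exists_angle {x : ℝ} (hx : x ∈ Icc (0 : ℝ) 1) :
    ∃ a ∈ Icc 0 Real.pi, (1 + Real.cos a) / 2 = x := by
  refine ⟨Real.arccos (2 * x - 1), ⟨Real.arccos_nonneg _, Real.arccos_le_pi _⟩, ?_⟩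
  rw [Real.cos_arccos (by linarith [hx.1]) (by linarith [hx.2])]
  ring

lemma hasFiniteLogPotential_densityMeasure {γ x : ℝ} (hγ : 1 < γ) (hx : x ∈ Icc (0 : ℝ) 1) :
    HasFiniteLogPotential (densityMeasure γ) x := by
  refine ⟨densityMeasure_singleton γ x, ?_⟩
  obtain ⟨a, -, rfl⟩ := exists_angle hx
  rw [integrable_densityMeasure_iff hγ]
  exact integrableOn_mul_angularDensity (integrableOn_log_sub_cos a) γ

lemma exists_logPotential_densityMeasure {γ : ℝ} (hγ : 1 < γ) :
    ∃ ℓ : ℝ, ∀ x ∈ Icc (0 : ℝ) 1,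
      2 * ∫ s, Real.log |x - s| ∂densityMeasure γ = besselFieldScaled γ x + ℓ := by
  obtain ⟨C, hC⟩ := exists_integral_log_mul_angularDensity hγ
  refine ⟨2 * C, fun x hx => ?_⟩
  obtain ⟨a, ha, rfl⟩ := exists_angle hx
  rw [integral_densityMeasure hγ, hC a ha]
  ring

lemma solvesEquilibriumProblem_densityMeasure {γ : ℝ} (hγ : 1 < γ) :
    SolvesEquilibriumProblem (besselFieldScaled γ) 0 1 (densityMeasure γ) := by
  obtain ⟨ℓ, hℓ⟩ := exists_logPotential_densityMeasure hγ
  refine ⟨isProbabilityMeasure_densityMeasure hγ, (support_densityMeasure hγ).subset, ℓ, ?_, ?_⟩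
  · rw [support_densityMeasure hγ]
    exact fun x hx => ⟨hasFiniteLogPotential_densityMeasure hγ hx, hℓ x hx⟩
  · exact fun x hx => (hℓ x hx.1).le

/-! ### Chebyshev moments and negativity of the energy -/

/-- The Chebyshev moment, on `[0, 1]`. -/
noncomputable def chebMoment (ν : Measure ℝ) (n : ℕ) : ℝ :=
  ∫ s, (Chebyshev.T ℝ n).eval (2 * s - 1) ∂ν

lemma two_mul_sub_one_mem {s : ℝ} (hs : s ∈ Icc (0 : ℝ) 1) : 2 * s - 1 ∈ Icc (-1 : ℝ) 1 :=
  ⟨by linarith [hs.1], by linarith [hs.2]⟩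

lemma abs_eval_T_le_one {X : ℝ} (hX : X ∈ Icc (-1 : ℝ) 1) (n : ℕ) :
    |(Chebyshev.T ℝ n).eval X| ≤ 1 := by
  rw [← Real.cos_arccos hX.1 hX.2, Chebyshev.T_real_cos]
  exact Real.abs_cos_le_one _

lemma integrable_of_continuous_of_ae_mem_Icc {ν : Measure ℝ} [IsFiniteMeasure ν]
    (h : ∀ᵐ s ∂ν, s ∈ Icc (0 : ℝ) 1) {f : ℝ → ℝ} (hf : Continuous f) : Integrable f ν := by
  obtain ⟨C, hC⟩ := isCompact_Icc.exists_bound_of_continuousOn (s := Icc (0 : ℝ) 1) hf.continuousOn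
  exact Integrable.of_bound hf.aestronglyMeasurable C (h.mono hC)

/-- The `T_n` span all polynomials, which are uniformly dense in the continuous functions on the
interval. -/
lemma eq_of_chebMoment_eq {ν μ : Measure ℝ} [IsFiniteMeasure ν] [IsFiniteMeasure μ]
    (hν : ∀ᵐ s ∂ν, s ∈ Icc (0 : ℝ) 1) (hμ : ∀ᵐ s ∂μ, s ∈ Icc (0 : ℝ) 1)
    (h : ∀ n, chebMoment ν n = chebMoment μ n) : ν = μ := by
  have hcont : ∀ p : ℝ[X], Continuous fun s : ℝ => p.eval (2 * s - 1) := fun p =>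
    p.continuous.comp (by fun_prop)
  have hp : ∀ p : ℝ[X], ∫ s, p.eval (2 * s - 1) ∂ν = ∫ s, p.eval (2 * s - 1) ∂μ := by
    intro p
    have hmem : p ∈ Submodule.span ℝ (Set.range (Chebyshev.chebyshevTsequence ℝ)) := by
      rw [Polynomial.Sequence.span]
      · trivial
      · intro i
        exact (isUnit_iff_ne_zero.2 (leadingCoeff_ne_zero.2 (Polynomial.Sequence.ne_zero _ i)))
    induction hmem using Submodule.span_induction with
    | mem x hx => obtain ⟨n, rfl⟩ := hx; exact h n
    | zero => simp
    | add x y _ _ hx hy =>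
      simp only [eval_add]
      rw [integral_add (integrable_of_continuous_of_ae_mem_Icc hν (hcont x))
        (integrable_of_continuous_of_ae_mem_Icc hν (hcont y)),
        integral_add (integrable_of_continuous_of_ae_mem_Icc hμ (hcont x))
        (integrable_of_continuous_of_ae_mem_Icc hμ (hcont y)), hx, hy]
    | smul a x _ hx =>
      simp only [eval_smul, smul_eq_mul, integral_const_mul, hx]
  apply ext_of_forall_integral_eq_of_IsFiniteMeasure
  intro f
  have key : ∀ ε > 0, |∫ s, f s ∂ν - ∫ s, f s ∂μ| ≤ ε * (ν.real univ + μ.real univ) := by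
    intro ε hε
    obtain ⟨p, hpε⟩ := exists_polynomial_near_of_continuousOn (-1) 1
      (fun X => f ((X + 1) / 2)) (f.continuous.comp (by fun_prop)).continuousOn ε hε
    have bound : ∀ τ : Measure ℝ, IsFiniteMeasure τ → (∀ᵐ s ∂τ, s ∈ Icc (0 : ℝ) 1) →
        |∫ s, f s ∂τ - ∫ s, p.eval (2 * s - 1) ∂τ| ≤ ε * τ.real univ := by
      intro τ _ hτ
      rw [← integral_sub (integrable_of_continuous_of_ae_mem_Icc hτ f.continuous)
        (integrable_of_continuous_of_ae_mem_Icc hτ (hcont p)), ← Real.norm_eq_abs]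
      refine norm_integral_le_of_norm_le_const (hτ.mono fun s hs => ?_)
      have := (hpε _ (two_mul_sub_one_mem hs)).le
      rw [show (2 * s - 1 + 1) / 2 = s by ring] at this
      rwa [Real.norm_eq_abs, abs_sub_comm]
    have b1 := bound ν inferInstance hν
    have b2 := bound μ inferInstance hμ
    rw [hp p] at b1
    rw [abs_le] at *
    constructor <;> linarith [b1.1, b1.2, b2.1, b2.2]
  have : |∫ s, f s ∂ν - ∫ s, f s ∂μ| ≤ 0 := by
    have hlim : Tendsto (fun ε : ℝ => ε * (ν.real univ + μ.real univ)) (𝓝[>] 0) (𝓝 0) := by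
      have : ContinuousAt (fun ε : ℝ => ε * (ν.real univ + μ.real univ)) 0 := by fun_prop
      simpa using this.tendsto.mono_left (nhdsWithin_le_nhds (s := Ioi 0))
    exact ge_of_tendsto hlim (eventually_mem_nhdsWithin.mono fun ε hε => key ε hε)
  exact sub_eq_zero.1 (abs_eq_zero.1 (le_antisymm this (abs_nonneg _)))

lemma ae_prod_mem_Icc {ν μ : Measure ℝ} [SFinite ν] [SFinite μ]
    (hν : ∀ᵐ s ∂ν, s ∈ Icc (0 : ℝ) 1) (hμ : ∀ᵐ s ∂μ, s ∈ Icc (0 : ℝ) 1) :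
    ∀ᵐ z ∂ν.prod μ, z.1 ∈ Icc (0 : ℝ) 1 ∧ z.2 ∈ Icc (0 : ℝ) 1 :=
  (Measure.quasiMeasurePreserving_fst.ae hν).and (Measure.quasiMeasurePreserving_snd.ae hμ)

lemma hasSum_integral_regLogKernel {ν μ : Measure ℝ} [IsFiniteMeasure ν] [IsFiniteMeasure μ]
    (hν : ∀ᵐ s ∂ν, s ∈ Icc (0 : ℝ) 1) (hμ : ∀ᵐ s ∂μ, s ∈ Icc (0 : ℝ) 1) {ρ : ℝ}
    (h0 : 0 ≤ ρ) (h1 : ρ < 1) :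
    HasSum (fun n : ℕ => 2 * (ρ ^ n / n) * (chebMoment ν n * chebMoment μ n))
      (-∫ z, regLogKernel ρ (2 * z.1 - 1) (2 * z.2 - 1) ∂ν.prod μ) := by
  have hae := ae_prod_mem_Icc hν hμ
  have hcont : ∀ n : ℕ, Continuous fun z : ℝ × ℝ => 2 * (ρ ^ n / n) *
      ((Chebyshev.T ℝ n).eval (2 * z.1 - 1) * (Chebyshev.T ℝ n).eval (2 * z.2 - 1)) := fun n =>
    continuous_const.mul (((Chebyshev.T ℝ n).continuous.comp (by fun_prop)).mul
      ((Chebyshev.T ℝ n).continuous.comp (by fun_prop)))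
  have hbound : ∀ n : ℕ, ∀ᵐ z ∂ν.prod μ, ‖2 * (ρ ^ n / n) *
      ((Chebyshev.T ℝ n).eval (2 * z.1 - 1) * (Chebyshev.T ℝ n).eval (2 * z.2 - 1))‖ ≤
      2 * ρ ^ n := by
    intro n
    filter_upwards [hae] with z hz
    have a1 := abs_eval_T_le_one (two_mul_sub_one_mem hz.1) n
    have a2 := abs_eval_T_le_one (two_mul_sub_one_mem hz.2) n
    have a3 : ρ ^ n / n ≤ ρ ^ n := by
      rcases Nat.eq_zero_or_pos n with rfl | hn
      · simp
      · exact div_le_self (by positivity) (by exact_mod_cast hn)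
    rw [norm_mul, norm_mul, Real.norm_eq_abs (_ : ℝ), Real.norm_eq_abs (ρ ^ n / n),
      abs_of_nonneg (by positivity : 0 ≤ ρ ^ n / n), norm_mul, Real.norm_eq_abs, Real.norm_eq_abs,
      abs_two]
    calc _ ≤ 2 * ρ ^ n * (1 * 1) := by gcongr
      _ = _ := by ring
  have h := hasSum_integral_of_summable_integral_norm (μ := ν.prod μ)
    (F := fun (n : ℕ) (z : ℝ × ℝ) => 2 * (ρ ^ n / n) *
      ((Chebyshev.T ℝ n).eval (2 * z.1 - 1) * (Chebyshev.T ℝ n).eval (2 * z.2 - 1)))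
    (fun n => Integrable.of_bound (hcont n).aestronglyMeasurable _ (hbound n)) ?_
  · have e1 : ∀ n : ℕ, ∫ z : ℝ × ℝ, 2 * (ρ ^ n / n) * ((Chebyshev.T ℝ n).eval (2 * z.1 - 1) *
        (Chebyshev.T ℝ n).eval (2 * z.2 - 1)) ∂ν.prod μ =
        2 * (ρ ^ n / n) * (chebMoment ν n * chebMoment μ n) := fun n => by
      rw [integral_const_mul, integral_prod_mul
        (fun s => (Chebyshev.T ℝ n).eval (2 * s - 1)) fun s => (Chebyshev.T ℝ n).eval (2 * s - 1)]
      rfl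
    have e2 : ∫ z : ℝ × ℝ, ∑' n : ℕ, 2 * (ρ ^ n / n) * ((Chebyshev.T ℝ n).eval (2 * z.1 - 1) *
        (Chebyshev.T ℝ n).eval (2 * z.2 - 1)) ∂ν.prod μ =
        -∫ z, regLogKernel ρ (2 * z.1 - 1) (2 * z.2 - 1) ∂ν.prod μ := by
      rw [← integral_neg]
      refine integral_congr_ae ?_
      filter_upwards [hae] with z hz
      exact (hasSum_regLogKernel h0 h1 (two_mul_sub_one_mem hz.1)
        (two_mul_sub_one_mem hz.2)).tsum_eq
    simpa only [e1, e2] using h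
  · refine Summable.of_nonneg_of_le (fun n => integral_nonneg fun _ => norm_nonneg _)
      (fun n => ?_) (((summable_geometric_of_lt_one h0 h1).mul_left 2).mul_right
        ((ν.prod μ).real univ))
    have := norm_integral_le_of_norm_le_const (μ := ν.prod μ) (C := 2 * ρ ^ n)
      (f := fun z : ℝ × ℝ => ‖2 * (ρ ^ n / n) *
      ((Chebyshev.T ℝ n).eval (2 * z.1 - 1) * (Chebyshev.T ℝ n).eval (2 * z.2 - 1))‖)
      ((hbound n).mono fun z hz => by rwa [norm_norm])
    exact (le_abs_self _).trans this

/-- The mutual logarithmic energy `∬ log |x - s| dν(x) dμ(s)`. -/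
noncomputable def logEnergy (ν μ : Measure ℝ) : ℝ :=
  ∫ z, Real.log (|z.1 - z.2|) ∂ν.prod μ

/-- Finiteness of the mutual logarithmic energy. -/
def HasFiniteLogEnergy (ν μ : Measure ℝ) : Prop :=
  (∀ᵐ z ∂ν.prod μ, z.1 ≠ z.2) ∧ Integrable (fun z => Real.log (|z.1 - z.2|)) (ν.prod μ)

/-- The constant is `log 4` because `X = 2s - 1` doubles distances and the kernel is `log(2|X -
Y|)`. It cancels in the energy of a difference of probability measures. -/
lemma tendsto_integral_regLogKernel_prod {ν μ : Measure ℝ} [IsProbabilityMeasure ν]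
    [IsProbabilityMeasure μ] (hν : ∀ᵐ s ∂ν, s ∈ Icc (0 : ℝ) 1) (hμ : ∀ᵐ s ∂μ, s ∈ Icc (0 : ℝ) 1)
    (h : HasFiniteLogEnergy ν μ) :
    Tendsto (fun ρ => ∫ z, regLogKernel ρ (2 * z.1 - 1) (2 * z.2 - 1) ∂ν.prod μ) (𝓝[<] 1)
      (𝓝 (Real.log 4 + logEnergy ν μ)) := by
  have hae := ae_prod_mem_Icc hν hμ
  have e : ∀ z : ℝ × ℝ, |2 * z.1 - 1 - (2 * z.2 - 1)| = 2 * |z.1 - z.2| := fun z => by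
    rw [show 2 * z.1 - 1 - (2 * z.2 - 1) = 2 * (z.1 - z.2) by ring, abs_mul, abs_two]
  have elog : ∀ k : ℝ, 0 < k → ∀ᵐ z ∂ν.prod μ, Real.log (k * |z.1 - z.2|) =
      Real.log k + Real.log (|z.1 - z.2|) := fun k hk => by
    filter_upwards [h.1] with z hz
    rw [Real.log_mul hk.ne' (abs_pos.2 (sub_ne_zero.2 hz)).ne']
  have := tendsto_integral_regLogKernel (τ := ν.prod μ) (f := fun z => 2 * z.1 - 1)
    (g := fun z => 2 * z.2 - 1) (by fun_prop) (by fun_prop)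
    (hae.mono fun z hz => two_mul_sub_one_mem hz.1) (hae.mono fun z hz => two_mul_sub_one_mem hz.2)
    (h.1.mono fun z hz hz' => hz (by linarith)) ?_
  · convert this using 2
    simp only [e]
    have e4 : ∀ᵐ z ∂ν.prod μ, Real.log (2 * (2 * |z.1 - z.2|)) =
        Real.log 4 + Real.log (|z.1 - z.2|) := (elog 4 (by norm_num)).mono fun z hz => by
      rw [← hz]; ring_nf
    rw [logEnergy, integral_congr_ae e4, integral_add (integrable_const _) h.2]
    simp
  · simp only [e]
    exact ((integrable_const _).add h.2).congr ((elog 2 (by norm_num)).mono fun _ hz => hz.symm)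

/-- For `ρ < 1` the regularised energy of `ν - μ` is minus a series of nonnegative terms, so it is
at most minus its `n`-th term. Letting `ρ → 1` leaves a nonnegative number bounded by `-(2/n)` times
a squared moment difference. -/
theorem eq_of_logEnergy_nonneg {ν μ : Measure ℝ} [IsProbabilityMeasure ν]
    [IsProbabilityMeasure μ] (hν : ∀ᵐ s ∂ν, s ∈ Icc (0 : ℝ) 1) (hμ : ∀ᵐ s ∂μ, s ∈ Icc (0 : ℝ) 1)
    (hνν : HasFiniteLogEnergy ν ν) (hνμ : HasFiniteLogEnergy ν μ) (hμμ : HasFiniteLogEnergy μ μ)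
    (h : 0 ≤ logEnergy ν ν + logEnergy μ μ - 2 * logEnergy ν μ) : ν = μ := by
  refine eq_of_chebMoment_eq hν hμ fun n => ?_
  have l := ((tendsto_integral_regLogKernel_prod hν hν hνν).add
    (tendsto_integral_regLogKernel_prod hμ hμ hμμ)).sub
    ((tendsto_integral_regLogKernel_prod hν hμ hνμ).const_mul 2)
  have key : ∀ᶠ ρ : ℝ in 𝓝[<] 1,
      (∫ z, regLogKernel ρ (2 * z.1 - 1) (2 * z.2 - 1) ∂ν.prod ν) +
      (∫ z, regLogKernel ρ (2 * z.1 - 1) (2 * z.2 - 1) ∂μ.prod μ) -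
      2 * (∫ z, regLogKernel ρ (2 * z.1 - 1) (2 * z.2 - 1) ∂ν.prod μ) ≤
      -(2 * (ρ ^ n / n) * (chebMoment ν n - chebMoment μ n) ^ 2) := by
    have : ∀ᶠ ρ : ℝ in 𝓝[<] 1, ρ ∈ Ioo (0 : ℝ) 1 := Ioo_mem_nhdsLT (by norm_num)
    filter_upwards [this] with ρ hρ
    have hs := ((hasSum_integral_regLogKernel hν hν hρ.1.le hρ.2).add
      (hasSum_integral_regLogKernel hμ hμ hρ.1.le hρ.2)).sub
      ((hasSum_integral_regLogKernel hν hμ hρ.1.le hρ.2).mul_left 2)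
    have e : ∀ m : ℕ, 2 * (ρ ^ m / m) * (chebMoment ν m * chebMoment ν m) +
        2 * (ρ ^ m / m) * (chebMoment μ m * chebMoment μ m) -
        2 * (2 * (ρ ^ m / m) * (chebMoment ν m * chebMoment μ m)) =
        2 * (ρ ^ m / m) * (chebMoment ν m - chebMoment μ m) ^ 2 := fun m => by ring
    simp only [e] at hs
    have hρ0 := hρ.1
    have := le_hasSum hs n fun m _ => by positivity
    linarith
  -- The coefficient at `n = 0` is zero, so this moment is compared directly: it is the total mass.
  rcases Nat.eq_zero_or_pos n with rfl | hn
  · simp [chebMoment]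
  have l2 : Tendsto (fun ρ : ℝ => -(2 * (ρ ^ n / n) * (chebMoment ν n - chebMoment μ n) ^ 2))
      (𝓝[<] 1) (𝓝 (-(2 * (1 ^ n / n) * (chebMoment ν n - chebMoment μ n) ^ 2))) := by
    have : ContinuousAt (fun ρ : ℝ => -(2 * (ρ ^ n / n) * (chebMoment ν n - chebMoment μ n) ^ 2)) 1 := by
      fun_prop
    exact this.tendsto.mono_left nhdsWithin_le_nhds
  have hle := le_of_tendsto_of_tendsto l l2 key
  have hn' : (0 : ℝ) < 2 * (1 ^ n / n) := by positivity
  have : (chebMoment ν n - chebMoment μ n) ^ 2 ≤ 0 := by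
    by_contra hcon
    have := mul_pos hn' (not_le.1 hcon)
    linarith
  exact sub_eq_zero.1 (pow_eq_zero_iff two_ne_zero |>.1 (le_antisymm this (sq_nonneg _)))

/-! ### From potentials to energies, and uniqueness -/

lemma continuous_besselFieldScaled (γ : ℝ) : Continuous (besselFieldScaled γ) := by
  have h : ∀ t : ℝ, besselFieldScaled γ t =
      2 * ((1 + √(t / γ)) * Real.log (1 + √(t / γ))) +
        2 * ((1 - √(t / γ)) * Real.log (1 - √(t / γ))) := fun t => by
    unfold besselFieldScaled besselField; ring
  rw [funext h]
  exact (continuous_const.mul (Real.continuous_mul_log.comp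
      (by fun_prop : Continuous fun t : ℝ => 1 + √(t / γ)))).add
    (continuous_const.mul (Real.continuous_mul_log.comp
      (by fun_prop : Continuous fun t : ℝ => 1 - √(t / γ))))

lemma norm_log_abs_sub {x s : ℝ} (hx : x ∈ Icc (0 : ℝ) 1) (hs : s ∈ Icc (0 : ℝ) 1) :
    ‖Real.log |x - s|‖ = -Real.log |x - s| := by
  rw [Real.norm_eq_abs, abs_of_nonpos]
  exact Real.log_nonpos (abs_nonneg _)
    (abs_le.2 ⟨by linarith [hx.1, hs.2], by linarith [hx.2, hs.1]⟩)

/-- On `[0,1]` the kernel is nonpositive, so its integral in absolute value is minus the potential,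
which is `ν`-integrable by the equation; Tonelli then gives joint integrability. The diagonal is
null because `μ` has no atom at `ν`-almost every point. -/
lemma logEnergy_of_logPotential_eq {ν μ : Measure ℝ} [IsProbabilityMeasure ν]
    [IsProbabilityMeasure μ] (hν : ∀ᵐ s ∂ν, s ∈ Icc (0 : ℝ) 1) (hμ : ∀ᵐ s ∂μ, s ∈ Icc (0 : ℝ) 1)
    {W : ℝ → ℝ} (hW : Continuous W) {ℓ : ℝ}
    (h : ∀ᵐ x ∂ν, HasFiniteLogPotential μ x ∧ 2 * ∫ s, Real.log |x - s| ∂μ = W x + ℓ) :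
    HasFiniteLogEnergy ν μ ∧ logEnergy ν μ = 1 / 2 * (∫ x, W x ∂ν + ℓ) := by
  have hWi := integrable_of_continuous_of_ae_mem_Icc hν hW
  have hmeas : Measurable fun z : ℝ × ℝ => Real.log |z.1 - z.2| := by fun_prop
  have hint : Integrable (fun z : ℝ × ℝ => Real.log |z.1 - z.2|) (ν.prod μ) := by
    rw [integrable_prod_iff hmeas.aestronglyMeasurable]
    refine ⟨h.mono fun x hx => hx.1.2, ?_⟩
    refine ((hWi.add (integrable_const ℓ)).const_mul (-(1 / 2))).congr ?_
    filter_upwards [h, hν] with x hx hx1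
    have : ∫ s, ‖Real.log |x - s|‖ ∂μ = -∫ s, Real.log |x - s| ∂μ := by
      rw [← integral_neg]
      exact integral_congr_ae (hμ.mono fun s hs => norm_log_abs_sub hx1 hs)
    rw [this]
    simp only [Pi.add_apply]
    linarith [hx.2]
  refine ⟨⟨?_, hint⟩, ?_⟩
  · have hD : MeasurableSet {z : ℝ × ℝ | z.1 = z.2} :=
      measurableSet_eq_fun measurable_fst measurable_snd
    have h0 : ν.prod μ {z : ℝ × ℝ | z.1 = z.2} = 0 := by
      rw [Measure.measure_prod_null hD]
      filter_upwards [h] with x hx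
      convert hx.1.1 using 2
      · ext s
        simp [eq_comm]
      · rfl
    exact measure_eq_zero_iff_ae_notMem.1 h0
  · rw [logEnergy, integral_prod _ hint]
    have e : ∀ᵐ x ∂ν, ∫ s, Real.log |x - s| ∂μ = 1 / 2 * (W x + ℓ) :=
      h.mono fun x hx => by linarith [hx.2]
    rw [integral_congr_ae e, integral_const_mul, integral_add hWi (integrable_const _)]
    simp

lemma logEnergy_le_of_logPotential_le {ν μ : Measure ℝ} [IsProbabilityMeasure ν]
    [IsProbabilityMeasure μ] (hμ : ∀ᵐ s ∂μ, s ∈ Icc (0 : ℝ) 1)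
    {W : ℝ → ℝ} (hW : Continuous W) {ℓ : ℝ} (hfin : HasFiniteLogEnergy ν μ)
    (h : ∀ᵐ x ∂μ, 2 * ∫ s, Real.log |x - s| ∂ν ≤ W x + ℓ) :
    logEnergy ν μ ≤ 1 / 2 * (∫ x, W x ∂μ + ℓ) := by
  have hWi := integrable_of_continuous_of_ae_mem_Icc hμ hW
  have e : 1 / 2 * (∫ x, W x ∂μ + ℓ) = ∫ x, 1 / 2 * (W x + ℓ) ∂μ := by
    rw [integral_const_mul, integral_add hWi (integrable_const _)]
    simp
  rw [logEnergy, integral_prod_symm _ hfin.2, e]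
  refine integral_mono_ae hfin.2.integral_prod_right
    ((hWi.add (integrable_const _)).const_mul _) (h.mono fun x hx => ?_)
  simp only [abs_sub_comm _ x]
  linarith

lemma SolvesEquilibriumProblem.ae_mem_Icc {W : ℝ → ℝ} {a b : ℝ} {ν : Measure ℝ}
    (h : SolvesEquilibriumProblem W a b ν) : ∀ᵐ s ∂ν, s ∈ Icc a b :=
  mem_of_superset Measure.support_mem_ae h.support_subset

lemma SolvesEquilibriumProblem.exists_logPotential {W : ℝ → ℝ} {a b : ℝ} {ν : Measure ℝ}
    (h : SolvesEquilibriumProblem W a b ν) : ∃ ℓ : ℝ,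
    (∀ᵐ x ∂ν, HasFiniteLogPotential ν x ∧ 2 * ∫ s, Real.log |x - s| ∂ν = W x + ℓ) ∧
    ∀ x ∈ Icc a b, 2 * ∫ s, Real.log |x - s| ∂ν ≤ W x + ℓ := by
  obtain ⟨ℓ, h1, h2⟩ := h.exists_const
  refine ⟨ℓ, mem_of_superset Measure.support_mem_ae h1, fun x hx => ?_⟩
  by_cases hs : x ∈ ν.support
  · exact (h1 x hs).2.le
  · exact h2 x ⟨hx, hs⟩

/-- A solution of the equilibrium problem with full support is the only solution. -/
theorem SolvesEquilibriumProblem.unique_of_support_eq {W : ℝ → ℝ} (hW : Continuous W)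
    {μ ν : Measure ℝ} (hμ : SolvesEquilibriumProblem W 0 1 μ) (hsupp : μ.support = Icc 0 1)
    (hν : SolvesEquilibriumProblem W 0 1 ν) : ν = μ := by
  have := hμ.isProbabilityMeasure
  have := hν.isProbabilityMeasure
  have hμ1 := hμ.ae_mem_Icc
  have hν1 := hν.ae_mem_Icc
  obtain ⟨ℓ, h1, -⟩ := hμ.exists_const
  rw [hsupp] at h1
  obtain ⟨ℓ', k1, k2⟩ := hν.exists_logPotential
  obtain ⟨fνν, eνν⟩ := logEnergy_of_logPotential_eq hν1 hν1 hW k1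
  -- Full support of `μ` is used here: its equality holds `ν`-almost everywhere.
  obtain ⟨fνμ, eνμ⟩ := logEnergy_of_logPotential_eq hν1 hμ1 hW (hν1.mono h1)
  obtain ⟨fμμ, eμμ⟩ := logEnergy_of_logPotential_eq hμ1 hμ1 hW (hμ1.mono h1)
  have hle := logEnergy_le_of_logPotential_le hμ1 hW fνμ (hμ1.mono k2)
  -- Replace one copy of the mutual energy by its value `eνμ` and bound the other by `hle`; all
  -- field integrals and constants then cancel.
  exact eq_of_logEnergy_nonneg hν1 hμ1 fνν fνμ fμμ (by linarith)

theorem lemma4p5 (γ : ℝ) (hγ : 1 < γ) :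
    ∃ μ : Measure ℝ,
      IsEquilibriumMeasure (besselFieldScaled γ) 0 1 μ ∧
      μ.support = Icc (0 : ℝ) 1 ∧
      (∀ s ∈ Ioo (0 : ℝ) 1, 0 < equilibriumDensity γ s) ∧
      μ = (volume.restrict (Ioo (0 : ℝ) 1)).withDensity
        (fun s => ENNReal.ofReal (equilibriumDensity γ s)) :=
  ⟨densityMeasure γ, ⟨solvesEquilibriumProblem_densityMeasure hγ, fun _ hν =>
    (solvesEquilibriumProblem_densityMeasure hγ).unique_of_support_eq
      (continuous_besselFieldScaled γ) (support_densityMeasure hγ) hν⟩,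
    support_densityMeasure hγ, fun _ hs => equilibriumDensity_pos hγ hs, rfl⟩
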